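/- Write $\mathbb{R}_-=(-\infty,0]$ and let $(T(t))_{t\ge 0}$ be the left translation semigroup on $X=L^1(\mathbb{R}_-)$: $(T(t)f)(s)=f(s+t)$ if $s+t\le 0$ and $0$ otherwise. It is a $C_0$-semigroup; its generator is $Af=f'$ with $D(A)=\{f\in W^{1,1}(\mathbb{R}_-): f(0)=0\}$, and $\rho(A)=\{\lambda\in\mathbb{C}:\operatorname{Re}\lambda>0\}$. Let $X_{-1}$ be the extrapolation space of $A$ (the completion of $X$ for the norm $\|R(\lambda_0,A)x\|$, for any fixed $\lambda_0\in\rho(A)$), $(T_{-1}(t))_{t\ge0}$ the extension of $(T(t))_{t\ge0}$ to $X_{-1}$ and $A_{-1}$ its generator. For $\lambda\in\rho(A)$ let $D_\lambda:\mathbb{C}\to L^1(\mathbb{R}_-)$ be the Dirichlet operator: $D_\lambda c$ is the unique $f\in W^{1,1}(\mathbb{R}_-)$ with $f'=\lambda f$, $f(0)=c$; thus $D_\lambda c=c\,e^{\lambda\,\cdot}$. Let $C\in C_0(\mathbb{R}_-)'$ with $\|C\|<1$, restricted to the Banach space $Z=L^1(\mathbb{R}_-)\cap C_0(\mathbb{R}_-)$,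 and put $U=\mathbb{C}$, $B=(\lambda-A_{-1})D_\lambda\in\mathcal{L}(U,X_{-1})$. Then $(B,C)$ is an infinite-time Staffans--Weiss perturbation of $A$, with exponent $p=1$. That is, $D(A)$ with the graph norm embeds continuously into $Z$, $Z$ embeds continuously into $X$, and: (i) $\operatorname{range}R(\nu,A_{-1})B\subseteq Z$ for some $\nu\in\rho(A)$; (ii) there is $M_B\ge 0$ such that for all $t>0$ and $u\in L^1(0,t)$ one has $\mathcal{B}_tu:=\int_0^tT_{-1}(t-s)Bu(s)\,ds\in X$ and $\|\mathcal{B}_tu\|_X\le M_B\|u\|_{L^1(0,t)}$; (iii) there are $t>0$ and $M_C\ge0$ with $\int_0^t|CT(s)x|\,ds\le M_C\|x\|$ for all $x\in D(A)$; (iv) there are $t>0$ and $M_{BC}\ge0$ such that $\int_0^t\bigl|C\int_0^rT_{-1}(r-s)Bu(s)\,ds\bigr|\,dr\le M_{BC}\|u\|_{L^1(0,t)}$ for all $u\in W^{2,1}(0,t)$ with $u(0)=u'(0)=0$, the inner integrals belonging to $Z$; (v) for every $t>0$ the bounded extensions $\mathcal{C}_t:X\to L^1(0,t)$ of $x\mapsto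 CT(\cdot)x$ (from $D(A)$) and $\mathcal{F}_t:L^1(0,t)\to L^1(0,t)$ of $u\mapsto C\int_0^{\cdot}T_{-1}(\cdot-s)Bu(s)\,ds$ (from the functions in (iv)) exist, $I-\mathcal{F}_t$ is invertible, and $\sup_{t>0}\|(I-\mathcal{F}_t)^{-1}\mathcal{C}_t\|<\infty$. Moreover, for all $t>0$ and $u\in L^1(0,t)$, $(\mathcal{B}_tu)(s)=u(s+t)$ for almost all $s\in(-t,0]$ and $(\mathcal{B}_tu)(s)=0$ for almost all $s<-t$, so that $\|\mathcal{B}_t\|\le 1$; and the input-output map $\mathcal{F}_\infty$ on $L^1(0,\infty)$, that is, the bounded extension of $u\mapsto C\int_0^{\cdot}T_{-1}(\cdot-s)Bu(s)\,ds$ from $\{u\in W^{2,1}(0,\infty):u(0)=u'(0)=0\}$, exists and satisfies $\|\mathcal{F}_\infty\|\le\|C\|<1$. (Here $\|C\|=|\mu|(\mathbb{R}_-)$ for the complex measure $\mu$ representing $C$.) -/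

import Mathlib

open MeasureTheory Filter Topology Set
open scoped ENNReal NNReal ZeroAtInfty

noncomputable section

namespace SW

section Semigroups

/-- A `C₀`-semigroup of bounded linear operators on a complex normed space. -/
structure C0Semigroup (X : Type*) [NormedAddCommGroup X] [NormedSpace ℂ X] where
  op : ℝ≥0 → X →L[ℂ] X
  op_zero : op 0 = ContinuousLinearMap.id ℂ X
  op_add : ∀ s t, op (s + t) = (op s).comp (op t)
  tendsto_zero : ∀ x, Tendsto (fun t => op t x) (𝓝[>] 0) (𝓝 x)

variable {X : Type*} [NormedAddCommGroup X] [NormedSpace ℂ X]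

/-- The graph of the generator of a family of operators `S`: all pairs `(x, y)` such that
`(S h x - x) / h` tends to `y` as `h` tends to `0` from the right. -/
def generatorGraph (S : ℝ≥0 → X →L[ℂ] X) : Submodule ℂ (X × X) where
  carrier := {q | Tendsto (fun h : ℝ≥0 => (((h : ℝ) : ℂ)⁻¹) • (S h q.1 - q.1)) (𝓝[>] 0) (𝓝 q.2)}
  zero_mem' := by simp
  add_mem' := by
    intro a b ha hb
    refine (Tendsto.add ha hb).congr fun h => ?_
    simp only [Prod.fst_add, map_add, ← smul_add]
    congr 1
    abel
  smul_mem' := by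
    intro c a ha
    refine (Tendsto.const_smul ha c).congr fun h => ?_
    simp only [Prod.smul_fst, map_smul, ← smul_sub]
    rw [smul_comm]

/-- The generator of a family of operators, as a partially defined linear operator. -/
def generator (S : ℝ≥0 → X →L[ℂ] X) : X →ₗ.[ℂ] X := (generatorGraph S).toLinearPMap

theorem generator_graph (S : ℝ≥0 → X →L[ℂ] X) : (generator S).graph = generatorGraph S := by
  refine Submodule.toLinearPMap_graph_eq _ ?_
  intro q hq h0
  have h1 : Tendsto (fun h : ℝ≥0 => (((h : ℝ) : ℂ)⁻¹) • (S h q.1 - q.1)) (𝓝[>] 0) (𝓝 q.2) := hq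
  rw [h0] at h1
  simp only [map_zero, sub_zero, smul_zero] at h1
  exact tendsto_nhds_unique h1 tendsto_const_nhds

/-- `R` is the bounded inverse of `μ - A : D(A) → X`. -/
def IsResolventAt (A : X →ₗ.[ℂ] X) (μ : ℂ) (R : X →L[ℂ] X) : Prop :=
  (∀ x, (R x, μ • R x - x) ∈ A.graph) ∧ ∀ q ∈ A.graph, R (μ • q.1 - q.2) = q.1

/-- The resolvent set `ρ(A)`. -/
def resolventSet (A : X →ₗ.[ℂ] X) : Set ℂ := {μ | ∃ R, IsResolventAt A μ R}

open Classical in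
/-- The resolvent `R(μ, A)` (and `0` if `μ ∉ ρ(A)`). -/
def resolvent (A : X →ₗ.[ℂ] X) (μ : ℂ) : X →L[ℂ] X :=
  if h : ∃ R, IsResolventAt A μ R then h.choose else 0

theorem resolvent_commute (T : C0Semigroup X) (μ : ℂ) (t : ℝ≥0) (x : X) :
    resolvent (generator T.op) μ (T.op t x) = T.op t (resolvent (generator T.op) μ x) := by
  unfold resolvent
  split_ifs with h
  · obtain ⟨h1, h2⟩ := h.choose_spec
    set R := h.choose
    have hx := h1 x
    have key : (T.op t (R x), T.op t (μ • R x - x)) ∈ (generator T.op).graph := by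
      rw [generator_graph] at hx ⊢
      have hx' : Tendsto (fun h : ℝ≥0 => (((h : ℝ) : ℂ)⁻¹) • (T.op h (R x) - R x)) (𝓝[>] 0)
        (𝓝 (μ • R x - x)) := hx
      refine (((T.op t).continuous.tendsto _).comp hx').congr fun s => ?_
      have : T.op t (T.op s (R x)) = T.op s (T.op t (R x)) := by
        rw [← ContinuousLinearMap.comp_apply, ← T.op_add, add_comm, T.op_add]
        rfl
      simp [this]
    have := h2 _ key
    simpa using this
  · simp

/-- The space `X` equipped with the seminorm `x ↦ ‖R(μ, A) x‖`, where `A` is the generator of `T`.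
It is a norm for `μ ∈ ρ(A)`. -/
def PreExtrapolation (_T : C0Semigroup X) (_μ : ℂ) : Type _ := X

instance (T : C0Semigroup X) (μ : ℂ) : AddCommGroup (PreExtrapolation T μ) :=
  inferInstanceAs (AddCommGroup X)

instance (T : C0Semigroup X) (μ : ℂ) : Module ℂ (PreExtrapolation T μ) :=
  inferInstanceAs (Module ℂ X)

/-- The resolvent as a linear map on the space carrying the extrapolated norm. -/
def preResolvent (T : C0Semigroup X) (μ : ℂ) : PreExtrapolation T μ →ₗ[ℂ] X :=
  (resolvent (generator T.op) μ).toLinearMap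

instance (T : C0Semigroup X) (μ : ℂ) : SeminormedAddCommGroup (PreExtrapolation T μ) :=
  SeminormedAddCommGroup.induced _ X (preResolvent T μ)

instance (T : C0Semigroup X) (μ : ℂ) : NormedSpace ℂ (PreExtrapolation T μ) :=
  NormedSpace.induced ℂ _ X (preResolvent T μ)

/-- The extrapolation space `X₋₁` of the generator `A` of `T`: the completion of `X` for the norm
`x ↦ ‖R(μ, A) x‖`. Different `μ ∈ ρ(A)` give equivalent norms. -/
abbrev Extrapolation (T : C0Semigroup X) (μ : ℂ) : Type _ :=
  UniformSpace.Completion (PreExtrapolation T μ)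

/-- The canonical map `X → X₋₁`. -/
def toExtrapolation (T : C0Semigroup X) (μ : ℂ) : X →L[ℂ] Extrapolation T μ :=
  (UniformSpace.Completion.toComplL (𝕜 := ℂ) (E := PreExtrapolation T μ)).comp
    (LinearMap.mkContinuous (F := PreExtrapolation T μ)
      ({ toFun := fun x => x, map_add' := fun _ _ => rfl, map_smul' := fun _ _ => rfl } :
        X →ₗ[ℂ] PreExtrapolation T μ)
      ‖resolvent (generator T.op) μ‖
      (fun x => (resolvent (generator T.op) μ).le_opNorm x))

/-- `T(t)` as a bounded operator for the extrapolated norm. -/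
def preExtrapolatedOp (T : C0Semigroup X) (μ : ℂ) (t : ℝ≥0) :
    PreExtrapolation T μ →L[ℂ] PreExtrapolation T μ :=
  LinearMap.mkContinuous (E := PreExtrapolation T μ) (F := PreExtrapolation T μ)
    ({ toFun := fun x => T.op t x, map_add' := fun x y => (T.op t).map_add x y,
       map_smul' := fun c x => (T.op t).map_smul c x } :
        PreExtrapolation T μ →ₗ[ℂ] PreExtrapolation T μ)
    ‖T.op t‖
    (fun x => (congrArg norm (resolvent_commute T μ t x)).trans_le
      ((T.op t).le_opNorm (resolvent (generator T.op) μ x)))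

/-- The extrapolated semigroup `T₋₁(t)` on `X₋₁`: the continuous extension of `T(t)`. -/
def extrapolatedOp (T : C0Semigroup X) (μ : ℂ) (t : ℝ≥0) :
    Extrapolation T μ →L[ℂ] Extrapolation T μ :=
  (preExtrapolatedOp T μ t).completion

/-- `A₋₁`, the generator of the extrapolated semigroup. -/
def extrapolatedGenerator (T : C0Semigroup X) (μ : ℂ) :
    Extrapolation T μ →ₗ.[ℂ] Extrapolation T μ :=
  generator (extrapolatedOp T μ)

theorem extrapolatedOp_toExtrapolation (T : C0Semigroup X) (μ : ℂ) (t : ℝ≥0) (x : X) :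
    extrapolatedOp T μ t (toExtrapolation T μ x) = toExtrapolation T μ (T.op t x) :=
  ContinuousLinearMap.completion_apply_coe (preExtrapolatedOp T μ t) x

theorem norm_toExtrapolation (T : C0Semigroup X) (μ : ℂ) (x : X) :
    ‖toExtrapolation T μ x‖ = ‖resolvent (generator T.op) μ x‖ :=
  UniformSpace.Completion.norm_coe (E := PreExtrapolation T μ) x

end Semigroups

section Perturbations

variable {X Z U : Type*} [NormedAddCommGroup X] [NormedSpace ℂ X]
  [NormedAddCommGroup Z] [NormedSpace ℂ Z] [NormedAddCommGroup U] [NormedSpace ℂ U]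

/-- `∫₀ʳ T₋₁(r - s) B u(s) ds`, an integral in `X₋₁`. -/
def convolution (T : C0Semigroup X) (μ : ℂ) (B : U →L[ℂ] Extrapolation T μ) (u : ℝ → U) (r : ℝ) :
    Extrapolation T μ :=
  ∫ s in (0 : ℝ)..r, extrapolatedOp T μ (r - s).toNNReal (B (u s))

/-- `X₁ ↪ Z ↪ X` with `Z` a Banach space: `j : Z → X` is the (injective, continuous) embedding,
and the domain `D(A)` with the graph norm embeds continuously into `Z`. -/
structure IsIntermediateSpace (T : C0Semigroup X) (j : Z →L[ℂ] X) : Prop where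
  complete : CompleteSpace Z
  injective : Function.Injective j
  domain_embeds : ∃ K : ℝ, ∀ q ∈ (generator T.op).graph,
    ∃ z : Z, j z = q.1 ∧ ‖z‖ ≤ K * (‖q.1‖ + ‖q.2‖)

/-- Compatibility: `range (R(ν, A₋₁) B) ⊆ Z` for some `ν ∈ ρ(A)`. (It is a fact that
`ρ(A) = ρ(A₋₁)`; here `ν` is asked to lie in both.) -/
def IsCompatible (T : C0Semigroup X) (μ : ℂ) (j : Z →L[ℂ] X) (B : U →L[ℂ] Extrapolation T μ) :
    Prop :=
  ∃ ν ∈ resolventSet (generator T.op), ν ∈ resolventSet (extrapolatedGenerator T μ) ∧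
    ∀ c : U, ∃ z : Z, resolvent (extrapolatedGenerator T μ) ν (B c) = toExtrapolation T μ (j z)

/-- `p`-admissibility of the control operator `B`. -/
def IsAdmissibleControl (T : C0Semigroup X) (μ : ℂ) (B : U →L[ℂ] Extrapolation T μ) (p : ℝ≥0∞) :
    Prop :=
  ∃ t : ℝ, 0 < t ∧ ∀ u : ℝ → U, MemLp u p (volume.restrict (Ioc 0 t)) →
    convolution T μ B u t ∈ range (toExtrapolation T μ)

/-- Infinite-time `p`-admissibility of the control operator `B`. -/
def IsInfiniteTimeAdmissibleControl (T : C0Semigroup X) (μ : ℂ) (B : U →L[ℂ] Extrapolation T μ)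
    (p : ℝ≥0∞) : Prop :=
  ∃ M : ℝ, 0 ≤ M ∧ ∀ t : ℝ, 0 < t → ∀ u : Lp U p (volume.restrict (Ioc 0 t)),
    ∃ x : X, toExtrapolation T μ x = convolution T μ B u t ∧ ‖x‖ ≤ M * ‖u‖

/-- `Φ` is the control map `𝓑ₜ : Lᵖ(0,t;U) → X`. -/
def IsControlMap (T : C0Semigroup X) (μ : ℂ) (B : U →L[ℂ] Extrapolation T μ) (p : ℝ≥0∞)
    [Fact (1 ≤ p)] (t : ℝ) (Φ : Lp U p (volume.restrict (Ioc 0 t)) →L[ℂ] X) : Prop :=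
  ∀ u, toExtrapolation T μ (Φ u) = convolution T μ B u t

/-- `p`-admissibility of the observation operator `C`. The function `z` is the orbit `s ↦ T(s)x`
regarded as a function with values in `Z`; it is unique since `j` is injective. -/
def IsAdmissibleObservation (T : C0Semigroup X) (j : Z →L[ℂ] X) (C : Z →L[ℂ] U) (p : ℝ≥0∞) :
    Prop :=
  ∃ M : ℝ, 0 ≤ M ∧ ∃ t : ℝ, 0 < t ∧ ∀ x ∈ (generator T.op).domain, ∃ z : ℝ → Z,
    (∀ s ∈ Ioc 0 t, j (z s) = T.op s.toNNReal x) ∧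
    MemLp (fun s => C (z s)) p (volume.restrict (Ioc 0 t)) ∧
    ∫ s in Ioc 0 t, ‖C (z s)‖ ^ p.toReal ≤ M * ‖x‖ ^ p.toReal

/-- `Ψ` is the observation map `𝓒ₜ : X → Lᵖ(0,t;U)`, the bounded operator with
`(Ψ x)(s) = C T(s) x` for all `x ∈ D(A)`. -/
def IsObservationMap (T : C0Semigroup X) (j : Z →L[ℂ] X) (C : Z →L[ℂ] U) (p : ℝ≥0∞)
    [Fact (1 ≤ p)] (t : ℝ) (Ψ : X →L[ℂ] Lp U p (volume.restrict (Ioc 0 t))) : Prop :=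
  ∀ x ∈ (generator T.op).domain, ∃ z : ℝ → Z,
    (∀ s ∈ Ioc 0 t, j (z s) = T.op s.toNNReal x) ∧
    Ψ x =ᵐ[volume.restrict (Ioc 0 t)] fun s => C (z s)

/-- `u` is (the continuous representative of) an element of `W^{2,p}(I;U)` with
`u(0) = u'(0) = 0`, where `I` is `(0,t]` or `(0,∞)`: the functions `u`, `u' = v` and `u'' = w` are
in `Lᵖ`, and `u`, `v` are the primitives of `v`, `w` vanishing at `0`. -/
def MemW2pZero (p : ℝ≥0∞) (I : Set ℝ) (u : ℝ → U) : Prop :=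
  MemLp u p (volume.restrict I) ∧
  ∃ v w : ℝ → U, MemLp v p (volume.restrict I) ∧ MemLp w p (volume.restrict I) ∧
    (∀ r ∈ I, u r = ∫ s in (0 : ℝ)..r, v s) ∧ (∀ r ∈ I, v r = ∫ s in (0 : ℝ)..r, w s)

/-- `p`-admissibility of the pair `(B, C)`. The function `z` is
`r ↦ ∫₀ʳ T₋₁(r - s) B u(s) ds` regarded as a function with values in `Z`. -/
def IsAdmissiblePair (T : C0Semigroup X) (μ : ℂ) (j : Z →L[ℂ] X) (B : U →L[ℂ] Extrapolation T μ)
    (C : Z →L[ℂ] U) (p : ℝ≥0∞) : Prop :=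
  ∃ M : ℝ, 0 ≤ M ∧ ∃ t : ℝ, 0 < t ∧ ∀ u : ℝ → U, MemW2pZero p (Ioc 0 t) u → ∃ z : ℝ → Z,
    (∀ r ∈ Ioc 0 t, toExtrapolation T μ (j (z r)) = convolution T μ B u r) ∧
    MemLp (fun r => C (z r)) p (volume.restrict (Ioc 0 t)) ∧
    ∫ r in Ioc 0 t, ‖C (z r)‖ ^ p.toReal ≤ M * ∫ r in Ioc 0 t, ‖u r‖ ^ p.toReal

/-- `F` is the input-output map on `Lᵖ(I;U)`, where `I` is `(0,t]` (the map `𝓕ₜ`) or `(0,∞)` (the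
map `𝓕_∞`): the bounded operator with `(F u)(r) = C ∫₀ʳ T₋₁(r - s) B u(s) ds` for all
`u ∈ W^{2,p}(I;U)` with `u(0) = u'(0) = 0`. -/
def IsInputOutputMap (T : C0Semigroup X) (μ : ℂ) (j : Z →L[ℂ] X) (B : U →L[ℂ] Extrapolation T μ)
    (C : Z →L[ℂ] U) (p : ℝ≥0∞) [Fact (1 ≤ p)] (I : Set ℝ)
    (F : Lp U p (volume.restrict I) →L[ℂ] Lp U p (volume.restrict I)) : Prop :=
  ∀ (u : ℝ → U) (φ : Lp U p (volume.restrict I)), MemW2pZero p I u →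
    φ =ᵐ[volume.restrict I] u → ∃ z : ℝ → Z,
      (∀ r ∈ I, toExtrapolation T μ (j (z r)) = convolution T μ B u r) ∧
      F φ =ᵐ[volume.restrict I] fun r => C (z r)

/-- `(B, C)`, with `C` defined on the intermediate space `j : Z → X`, is a Staffans–Weiss
perturbation (with exponent `p`) of the generator of `T`. The extrapolation space is
formed with the norm `x ↦ ‖R(μ, A) x‖`, `μ ∈ ρ(A)`. -/
structure IsStaffansWeiss (T : C0Semigroup X) (μ : ℂ) (j : Z →L[ℂ] X)
    (B : U →L[ℂ] Extrapolation T μ) (C : Z →L[ℂ] U) (p : ℝ≥0∞) [Fact (1 ≤ p)] : Prop where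
  ne_top : p ≠ ∞
  base_point : μ ∈ resolventSet (generator T.op)
  intermediate : IsIntermediateSpace T j
  compatible : IsCompatible T μ j B
  control : IsAdmissibleControl T μ B p
  observation : IsAdmissibleObservation T j C p
  pair : IsAdmissiblePair T μ j B C p
  invertible : ∃ t : ℝ, 0 < t ∧
    ∃ F : Lp U p (volume.restrict (Ioc 0 t)) →L[ℂ] Lp U p (volume.restrict (Ioc 0 t)),
      IsInputOutputMap T μ j B C p (Ioc 0 t) F ∧ IsUnit (1 - F)

/-- `(B, C)` is an infinite-time Staffans–Weiss perturbation (with exponent `p`) of the generator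
of `T`. -/
structure IsInfiniteTimeStaffansWeiss (T : C0Semigroup X) (μ : ℂ) (j : Z →L[ℂ] X)
    (B : U →L[ℂ] Extrapolation T μ) (C : Z →L[ℂ] U) (p : ℝ≥0∞) [Fact (1 ≤ p)] : Prop
    extends IsStaffansWeiss T μ j B C p where
  infinite_control : IsInfiniteTimeAdmissibleControl T μ B p
  uniform_inverse : ∃ K : ℝ, ∀ t : ℝ, 0 < t →
    ∃ (F : Lp U p (volume.restrict (Ioc 0 t)) →L[ℂ] Lp U p (volume.restrict (Ioc 0 t)))
      (Ψ : X →L[ℂ] Lp U p (volume.restrict (Ioc 0 t))),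
      IsInputOutputMap T μ j B C p (Ioc 0 t) F ∧ IsObservationMap T j C p t Ψ ∧
      IsUnit (1 - F) ∧ ‖(Ring.inverse (1 - F)).comp Ψ‖ ≤ K

end Perturbations

section Translation

/-- `L¹(ℝ₋)`, `ℝ₋ = (-∞, 0]`. -/
abbrev L1Neg : Type := Lp ℂ 1 (volume.restrict (Iic (0 : ℝ)))

theorem memLp_zeroExtension (f : L1Neg) :
    MemLp ((Iic (0 : ℝ)).indicator f) 1 (volume : Measure ℝ) :=
  (memLp_indicator_iff_restrict measurableSet_Iic).2 (Lp.memLp f)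

theorem norm_toLp_zeroExtension (f : L1Neg) :
    ‖(memLp_zeroExtension f).toLp ((Iic (0 : ℝ)).indicator f)‖ ≤ 1 * ‖f‖ := by
  rw [one_mul, Lp.norm_toLp, eLpNorm_indicator_eq_eLpNorm_restrict measurableSet_Iic, Lp.norm_def]

/-- Extension by zero `L¹(ℝ₋) → L¹(ℝ)`, as a linear map. -/
def zeroExtensionLinear : L1Neg →ₗ[ℂ] Lp ℂ 1 (volume : Measure ℝ) where
  toFun := fun f => (memLp_zeroExtension f).toLp ((Iic (0 : ℝ)).indicator f)
  map_add' := by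
    intro f g
    rw [← MemLp.toLp_add]
    refine MemLp.toLp_congr _ _ ?_
    rw [← indicator_add']
    exact (ae_eq_restrict_iff_indicator_ae_eq measurableSet_Iic).1 (Lp.coeFn_add f g)
  map_smul' := by
    intro c f
    rw [RingHom.id_apply, ← MemLp.toLp_const_smul]
    refine MemLp.toLp_congr _ _ ?_
    have h := (ae_eq_restrict_iff_indicator_ae_eq measurableSet_Iic).1 (Lp.coeFn_smul c f)
    refine h.trans (Eventually.of_forall fun s => ?_)
    simp only [indicator_apply, Pi.smul_apply]
    split_ifs <;> simp

/-- Extension by zero `L¹(ℝ₋) → L¹(ℝ)`. -/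
def zeroExtension : L1Neg →L[ℂ] Lp ℂ 1 (volume : Measure ℝ) :=
  zeroExtensionLinear.mkContinuous 1 norm_toLp_zeroExtension

theorem zeroExtension_coeFn (f : L1Neg) :
    zeroExtension f =ᵐ[volume] (Iic (0 : ℝ)).indicator f :=
  MemLp.coeFn_toLp (memLp_zeroExtension f)

/-- Translation `f ↦ f(· + t)` on `L¹(ℝ)`. -/
def translation (t : ℝ) : Lp ℂ 1 (volume : Measure ℝ) →L[ℂ] Lp ℂ 1 (volume : Measure ℝ) :=
  (Lp.compMeasurePreservingₗᵢ ℂ (fun s => s + t)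
    (measurePreserving_add_right volume t)).toContinuousLinearMap

theorem translation_coeFn (t : ℝ) (f : Lp ℂ 1 (volume : Measure ℝ)) :
    translation t f =ᵐ[volume] fun s => f (s + t) :=
  Lp.coeFn_compMeasurePreserving f (measurePreserving_add_right volume t)

/-- The left translation operators on `L¹(ℝ₋)`: `(T(t)f)(s) = f(s + t)` if `s + t ≤ 0`, and
`(T(t)f)(s) = 0` otherwise. -/
def leftTranslationOp (t : ℝ≥0) : L1Neg →L[ℂ] L1Neg :=
  (LpToLpRestrictCLM ℝ ℂ ℂ volume 1 (Iic (0 : ℝ))).comp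
    ((translation (t : ℝ)).comp zeroExtension)

theorem leftTranslationOp_coeFn (t : ℝ≥0) (f : L1Neg) :
    leftTranslationOp t f =ᵐ[volume.restrict (Iic (0 : ℝ))]
      fun s => (Iic (0 : ℝ)).indicator f (s + t) := by
  have h1 := LpToLpRestrictCLM_coeFn ℂ (Iic (0 : ℝ)) (translation (t : ℝ) (zeroExtension f))
  have h2 := ae_restrict_of_ae (s := Iic (0 : ℝ)) (translation_coeFn t (zeroExtension f))
  have h3 := ae_restrict_of_ae (s := Iic (0 : ℝ))
    ((measurePreserving_add_right volume (t : ℝ)).quasiMeasurePreserving.ae_eq_comp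
      (zeroExtension_coeFn f))
  filter_upwards [h1, h2, h3] with s h1 h2 h3
  exact h1.trans (h2.trans h3)

theorem restrict_zeroExtension (f : L1Neg) :
    LpToLpRestrictCLM ℝ ℂ ℂ volume 1 (Iic (0 : ℝ)) (zeroExtension f) = f := by
  apply Lp.ext
  have h1 := LpToLpRestrictCLM_coeFn ℂ (Iic (0 : ℝ)) (zeroExtension f)
  have h2 := ae_restrict_of_ae (s := Iic (0 : ℝ)) (zeroExtension_coeFn f)
  filter_upwards [h1, h2, ae_restrict_mem measurableSet_Iic] with s h1 h2 hs
  rw [h1, h2, indicator_of_mem hs]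

theorem translation_tendsto (f : Lp ℂ 1 (volume : Measure ℝ)) :
    Tendsto (fun t : ℝ≥0 => translation (t : ℝ) f) (𝓝[>] 0) (𝓝 f) := by
  have hc : Continuous fun t : ℝ => (translation t f) := by
    let g : ℝ → C(ℝ, ℝ) := fun t => ⟨fun s => s + t, by fun_prop⟩
    have hg : Continuous g := ContinuousMap.continuous_of_continuous_uncurry _ (by
      change Continuous fun q : ℝ × ℝ => q.2 + q.1
      fun_prop)
    exact Continuous.compMeasurePreservingLp (continuous_const (y := f)) hg
      (fun t => measurePreserving_add_right volume t) ENNReal.one_ne_top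
  have h0 : translation 0 f = f := by
    apply Lp.ext
    simpa using translation_coeFn 0 f
  have h2 : Continuous fun t : ℝ≥0 => translation (t : ℝ) f := hc.comp NNReal.continuous_coe
  have h3 := h2.tendsto 0
  simp only [NNReal.coe_zero, h0] at h3
  exact h3.mono_left nhdsWithin_le_nhds

/-- The left translation semigroup on `L¹(ℝ₋)`. -/
def leftTranslation : C0Semigroup L1Neg where
  op := leftTranslationOp
  op_zero := by
    ext1 f
    apply Lp.ext
    filter_upwards [leftTranslationOp_coeFn 0 f, ae_restrict_mem measurableSet_Iic] with s h hs
    rw [h]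
    simp only [NNReal.coe_zero, add_zero, indicator_of_mem hs, ContinuousLinearMap.id_apply]
  op_add := by
    intro a b
    ext1 f
    apply Lp.ext
    have h3 : (Iic (0 : ℝ)).indicator (leftTranslationOp b f) =ᵐ[volume]
        (Iic (0 : ℝ)).indicator fun s => (Iic (0 : ℝ)).indicator f (s + b) :=
      (ae_eq_restrict_iff_indicator_ae_eq measurableSet_Iic).1 (leftTranslationOp_coeFn b f)
    have h4 := ae_restrict_of_ae (s := Iic (0 : ℝ))
      ((measurePreserving_add_right volume (a : ℝ)).quasiMeasurePreserving.ae_eq_comp h3)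
    filter_upwards [leftTranslationOp_coeFn (a + b) f,
      leftTranslationOp_coeFn a (leftTranslationOp b f), h4] with s h1 h2 h4
    rw [h1, ContinuousLinearMap.comp_apply, h2]
    simp only [Function.comp_apply] at h4
    rw [h4]
    simp only [indicator_apply, mem_Iic, NNReal.coe_add]
    have ha := a.2
    have hb := b.2
    have hb' : (0 : ℝ) ≤ b := hb
    by_cases h : s + (a + b : ℝ) ≤ 0
    · rw [if_pos h, if_pos (by linarith), if_pos (by linarith)]
      congr 1
      ring
    · rw [if_neg h]
      split_ifs with h5 h6
      · exact absurd (by linarith) h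
      · rfl
      · rfl
  tendsto_zero := by
    intro f
    have h := ((LpToLpRestrictCLM ℝ ℂ ℂ volume 1 (Iic (0 : ℝ))).continuous.tendsto _).comp
      (translation_tendsto (zeroExtension f))
    rw [restrict_zeroExtension] at h
    exact h

/-- `f ∈ W^{1,1}(ℝ₋)`, `f' = g` and `f(0) = c`: the function `f` is the primitive of `g` with value
`c` at `0` (`f` and `g` both being in `L¹(ℝ₋)`). -/
def IsW11 (f g : L1Neg) (c : ℂ) : Prop :=
  f =ᵐ[volume.restrict (Iic (0 : ℝ))] fun s => c - ∫ r in s..0, g r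

/-- `D` is the Dirichlet operator `(δ₀ |_{ker(ν - d/ds)})⁻¹`, where `d/ds` has the domain
`W^{1,1}(ℝ₋)`: `D c` is the only `f ∈ W^{1,1}(ℝ₋)` with `f' = ν f` and `f(0) = c`. -/
def IsDirichletOperator (ν : ℂ) (D : ℂ →L[ℂ] L1Neg) : Prop :=
  ∀ (c : ℂ) (f : L1Neg), D c = f ↔ IsW11 f (ν • f) c

/-- `B = (ν - A₋₁) D`. -/
def IsBoundaryControl (T : C0Semigroup L1Neg) (μ ν : ℂ) (D : ℂ →L[ℂ] L1Neg)
    (B : ℂ →L[ℂ] Extrapolation T μ) : Prop :=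
  ∀ c : ℂ, ∃ y, (toExtrapolation T μ (D c), y) ∈ (extrapolatedGenerator T μ).graph ∧
    B c = ν • toExtrapolation T μ (D c) - y

/-- The space `Z = L¹(ℝ₋) ∩ C₀(ℝ₋)`, with the norm `max ‖f‖₁ ‖f‖_∞`, realized as the space of all
pairs `(f, g) ∈ L¹(ℝ₋) × C₀(ℝ₋)` with `f = g` almost everywhere. -/
def l1CapC0 : Submodule ℂ (L1Neg × C₀(Iic (0 : ℝ), ℂ)) where
  carrier := {q | ∀ᵐ s ∂(volume.restrict (Iic (0 : ℝ))), ∀ hs : s ∈ Iic (0 : ℝ),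
    q.1 s = q.2 ⟨s, hs⟩}
  zero_mem' := by
    filter_upwards [Lp.coeFn_zero ℂ 1 (volume.restrict (Iic (0 : ℝ)))] with s h hs
    simpa using h
  add_mem' := by
    intro a b ha hb
    filter_upwards [ha, hb, Lp.coeFn_add a.1 b.1] with s h1 h2 h3 hs
    rw [Prod.fst_add, h3, Pi.add_apply, h1 hs, h2 hs]
    rfl
  smul_mem' := by
    intro c a ha
    filter_upwards [ha, Lp.coeFn_smul c a.1] with s h1 h2 hs
    rw [Prod.smul_fst, h2, Pi.smul_apply, h1 hs]
    rfl

/-- The embedding `L¹(ℝ₋) ∩ C₀(ℝ₋) → L¹(ℝ₋)`. -/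
def l1CapC0ToL1 : l1CapC0 →L[ℂ] L1Neg :=
  (ContinuousLinearMap.fst ℂ L1Neg C₀(Iic (0 : ℝ), ℂ)).comp l1CapC0.subtypeL

/-- The embedding `L¹(ℝ₋) ∩ C₀(ℝ₋) → C₀(ℝ₋)`. -/
def l1CapC0ToC0 : l1CapC0 →L[ℂ] C₀(Iic (0 : ℝ), ℂ) :=
  (ContinuousLinearMap.snd ℂ L1Neg C₀(Iic (0 : ℝ), ℂ)).comp l1CapC0.subtypeL

/-- The restriction of a functional `C ∈ C₀(ℝ₋)'` to `L¹(ℝ₋) ∩ C₀(ℝ₋)`. -/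
def restrictFunctional (C : C₀(Iic (0 : ℝ), ℂ) →L[ℂ] ℂ) : l1CapC0 →L[ℂ] ℂ :=
  ContinuousLinearMap.comp C l1CapC0ToC0

end Translation

end SW

end

/-!
The left translation semigroup `T` on `L¹(ℝ₋)` is a contraction semigroup with continuous orbits. For
such a semigroup the graph of the generator is described by `T(h)f - f = ∫₀ʰ T(r)g dr` for all `h`
(`mem_generator_graph_iff_integral`), and the resolvent is the Laplace transform of the orbits
(`isResolventAt_laplaceTransform`). Bochner integrals in `L¹` can be computed pointwise
(`coeFn_integral_ae_eq`). Hence, taking `h` large, the integrated equation is the variation of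
constants formula (`coeFn_eq_of_mem_generator_graph`). It identifies the generator as `f ↦ f'` with
`f(0) = 0`, and it shows that `ν` with `Re ν ≤ 0` is not in the resolvent set, because `e^{ν·}` is
then not integrable.

The resolvent `R(μ, A)` extends to an isometric isomorphism `X₋₁ ≃ X` which intertwines `T₋₁` with `T`
and `A₋₁` with `A` (`extrapolatedResolvent`), so every statement about `X₋₁` can be transported to
`L¹(ℝ₋)`. Under this isomorphism `B = (ν - A₋₁) D_ν` becomes the Dirichlet operator `D_μ`, for every
`ν`, and the convolution integral becomes `∫₀ᵗ T(t - s) D_μ u(s) ds`, which is computed to be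
`R(μ, A)` applied to the function `s ↦ u(s + t)` (extended by zero). This gives the control map
(`toExtrapolation_controlMap`).

Observation maps and input-output maps are both restrictions of one operator, the bounded extension
of `ψ ↦ (r ↦ C (ψ(· + r)))` from primitives of integrable functions to `L¹`
(`observationOperator`). Its norm is at most `‖C‖`. If `C` is given by a measure, this is Young's
inequality; the proof here is by duality (`lintegral_enorm_functional_le`): multiplying by a
unimodular function `a` one has `∫ |C z(r)| dr = C (∫ a(r) z(r) dr)`, and the function
`∫ a(r) z(r) dr` is bounded by `sup_σ ∫ |z(r)(σ)| dr`. Primitives are dense in `L¹(ℝ)`, since the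
averages of an orbit of the right translation semigroup are primitives. As `‖F_t‖ ≤ ‖C‖ < 1`, the
Neumann series inverts `1 - F_t` with a bound which is uniform in `t`.
-/

noncomputable section

namespace SW

/-! ### Generators of semigroups with continuous orbits -/

section AbstractSemigroups

variable {X : Type*} [NormedAddCommGroup X] [NormedSpace ℂ X]

theorem mem_generator_graph_iff (S : ℝ≥0 → X →L[ℂ] X) (f g : X) :
    (f, g) ∈ (generator S).graph ↔
      Tendsto (fun h : ℝ≥0 => (((h : ℝ) : ℂ)⁻¹) • (S h f - f)) (𝓝[>] 0) (𝓝 g) := by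
  rw [generator_graph]
  rfl

theorem IsResolventAt.eq {A : X →ₗ.[ℂ] X} {μ : ℂ} {R R' : X →L[ℂ] X}
    (h : IsResolventAt A μ R) (h' : IsResolventAt A μ R') : R = R' := by
  ext x
  simpa using h.2 _ (h'.1 x)

theorem isResolventAt_resolvent {A : X →ₗ.[ℂ] X} {μ : ℂ} (h : μ ∈ resolventSet A) :
    IsResolventAt A μ (resolvent A μ) := by
  have h' : ∃ R, IsResolventAt A μ R := h
  rw [resolvent, dif_pos h']
  exact h'.choose_spec

theorem IsResolventAt.resolvent_eq {A : X →ₗ.[ℂ] X} {μ : ℂ} {R : X →L[ℂ] X}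
    (h : IsResolventAt A μ R) : resolvent A μ = R :=
  (isResolventAt_resolvent ⟨R, h⟩).eq h

/-- All orbits `t ↦ S(t)x` of the semigroup are continuous on the whole half-line. -/
def HasContinuousOrbits (S : C0Semigroup X) : Prop := ∀ x, Continuous fun t => S.op t x

variable {S : C0Semigroup X}

theorem HasContinuousOrbits.comp_toNNReal (hS : HasContinuousOrbits S) (x : X) :
    Continuous fun r : ℝ => S.op r.toNNReal x :=
  (hS x).comp continuous_real_toNNReal

theorem op_op_comm (S : C0Semigroup X) (s t : ℝ≥0) (x : X) :
    S.op s (S.op t x) = S.op t (S.op s x) := by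
  rw [← ContinuousLinearMap.comp_apply, ← S.op_add, add_comm, S.op_add,
    ContinuousLinearMap.comp_apply]

theorem op_toNNReal_add (S : C0Semigroup X) (h : ℝ≥0) {r : ℝ} (hr : 0 ≤ r) (x : X) :
    S.op (r + h).toNNReal x = S.op h (S.op r.toNNReal x) := by
  rw [Real.toNNReal_add hr h.coe_nonneg, Real.toNNReal_coe, add_comm, S.op_add,
    ContinuousLinearMap.comp_apply]

/-- Right derivatives at `0` in the form in which difference quotients occur in `generatorGraph`. -/
theorem tendsto_inv_smul_nnreal {F : ℝ → X} {y : X} (hF : HasDerivWithinAt F y (Ioi 0) 0) :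
    Tendsto (fun h : ℝ≥0 => (((h : ℝ) : ℂ)⁻¹) • (F h - F 0)) (𝓝[>] 0) (𝓝 y) := by
  rw [hasDerivWithinAt_iff_tendsto_slope' (by simp)] at hF
  have hc : Tendsto (fun h : ℝ≥0 => (h : ℝ)) (𝓝[>] 0) (𝓝[>] 0) := by
    refine tendsto_nhdsWithin_iff.2 ⟨?_, ?_⟩
    · exact (NNReal.continuous_coe.tendsto' 0 0 rfl).mono_left nhdsWithin_le_nhds
    · filter_upwards [self_mem_nhdsWithin] with h hh
      exact NNReal.coe_pos.2 hh
  refine (hF.comp hc).congr fun h => ?_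
  simp only [Function.comp_apply, slope, vsub_eq_sub, sub_zero]
  rw [← Complex.ofReal_inv, Complex.coe_smul]

/-- The orbit integral `∫₀ʰ S(r)x dr`. -/
def orbitIntegral (S : C0Semigroup X) (h : ℝ≥0) (x : X) : X :=
  ∫ r in (0 : ℝ)..h, S.op r.toNNReal x

variable [CompleteSpace X]

/-- The averages of an orbit over `[0, h]` tend to its initial value. -/
theorem tendsto_average_orbit (hS : HasContinuousOrbits S) (x : X) :
    Tendsto (fun h : ℝ≥0 => (((h : ℝ) : ℂ)⁻¹) • orbitIntegral S h x)
      (𝓝[>] 0) (𝓝 x) := by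
  have hd := ((hS.comp_toNNReal x).integral_hasStrictDerivAt 0 0).hasDerivAt
  simp only [Real.toNNReal_zero, S.op_zero, ContinuousLinearMap.id_apply] at hd
  refine (tendsto_inv_smul_nnreal hd.hasDerivWithinAt).congr fun h => ?_
  simp [orbitIntegral]

/-- The graph of the generator in integrated form: `S(h)f - f = ∫₀ʰ S(r)g dr` for all `h`. -/
theorem mem_generator_graph_iff_integral (hS : HasContinuousOrbits S) (f g : X) :
    (f, g) ∈ (generator S.op).graph ↔
      ∀ h : ℝ≥0, S.op h f - f = orbitIntegral S h g := by
  rw [mem_generator_graph_iff]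
  constructor
  · intro hfg h
    have key := intervalIntegral.integral_eq_sub_of_hasDeriv_right_of_le (a := 0) (b := (h : ℝ)) h.2
      (f := fun r : ℝ => S.op r.toNNReal f) (f' := fun r : ℝ => S.op r.toNNReal g)
      (hS.comp_toNNReal f).continuousOn ?_ ((hS.comp_toNNReal g).intervalIntegrable _ _)
    · rw [orbitIntegral, key]
      simp [S.op_zero]
    intro t ht
    rw [hasDerivWithinAt_iff_tendsto_slope' (by simp)]
    have h1 := ((S.op t.toNNReal).continuous.tendsto _).comp hfg
    have h2 : Tendsto (fun s : ℝ => (s - t).toNNReal) (𝓝[>] t) (𝓝[>] 0) := by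
      refine tendsto_nhdsWithin_iff.2 ⟨?_, ?_⟩
      · exact ((continuous_real_toNNReal.comp (continuous_sub_right t)).tendsto' t 0
          (by simp)).mono_left nhdsWithin_le_nhds
      · filter_upwards [self_mem_nhdsWithin] with s hs
        exact Real.toNNReal_pos.2 (sub_pos.2 hs)
    refine (h1.comp h2).congr' ?_
    filter_upwards [self_mem_nhdsWithin] with s hs
    have hs' : 0 < s - t := sub_pos.2 hs
    have h3 : S.op s.toNNReal f = S.op t.toNNReal (S.op (s - t).toNNReal f) := by
      rw [op_op_comm, ← op_toNNReal_add S _ ht.1.le, Real.coe_toNNReal _ hs'.le,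
        add_sub_cancel]
    simp only [Function.comp_apply, slope, vsub_eq_sub]
    rw [Real.coe_toNNReal _ hs'.le, h3, ← map_sub, ← Complex.coe_smul, Complex.ofReal_inv, map_smul]
  · intro hfg
    exact (tendsto_average_orbit hS g).congr fun h => by rw [hfg h]

/-- Orbit integrals lie in the domain of the generator. -/
theorem integral_mem_generator_graph (hS : HasContinuousOrbits S) (x : X) (h : ℝ≥0) :
    (orbitIntegral S h x, S.op h x - x) ∈ (generator S.op).graph := by
  rw [mem_generator_graph_iff_integral hS]
  intro k
  simp only [orbitIntegral]
  have hi : ∀ a b : ℝ, IntervalIntegrable (fun r : ℝ => S.op r.toNNReal x) volume a b :=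
    fun a b => (hS.comp_toNNReal x).intervalIntegrable _ _
  have shift : ∀ a b : ℝ≥0, S.op a (∫ r in (0 : ℝ)..b, S.op r.toNNReal x) =
      ∫ r in (a : ℝ)..(b + a), S.op r.toNNReal x := by
    intro a b
    rw [← ContinuousLinearMap.intervalIntegral_comp_comm _ (hi _ _)]
    have := intervalIntegral.integral_comp_add_right (a := 0) (b := (b : ℝ))
      (fun r : ℝ => S.op r.toNNReal x) (a : ℝ)
    rw [zero_add] at this
    rw [← this]
    refine intervalIntegral.integral_congr fun r hr => ?_
    rw [uIcc_of_le b.coe_nonneg] at hr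
    exact (op_toNNReal_add S a hr.1 x).symm
  simp only [map_sub, op_op_comm S _ h x]
  rw [intervalIntegral.integral_sub]
  · rw [ContinuousLinearMap.intervalIntegral_comp_comm _ (hi _ _), shift, shift, add_comm (h : ℝ),
      ← intervalIntegral.integral_add_adjacent_intervals (hi k 0) (hi 0 (k + h)),
      ← intervalIntegral.integral_add_adjacent_intervals (hi h 0) (hi 0 (k + h)),
      intervalIntegral.integral_symm (0 : ℝ) (k : ℝ), intervalIntegral.integral_symm (0 : ℝ) (h : ℝ)]
    abel
  · exact ((S.op h).continuous.comp (hS.comp_toNNReal x)).intervalIntegrable _ _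
  · exact hi _ _

theorem denseRange_fst_generator_graph (hS : HasContinuousOrbits S) :
    DenseRange fun q : (generator S.op).graph => q.1.1 := by
  intro x
  refine mem_closure_of_tendsto (tendsto_average_orbit hS x) (Eventually.of_forall fun h => ?_)
  exact ⟨⟨_, Submodule.smul_mem _ (((h : ℝ) : ℂ)⁻¹) (integral_mem_generator_graph hS x h)⟩, rfl⟩

end AbstractSemigroups

/-! ### Rescaled semigroups and resolvents of contraction semigroups -/

section Rescaling

variable {X : Type*} [NormedAddCommGroup X] [NormedSpace ℂ X]

/-- The rescaled semigroup `t ↦ e^{-νt} S(t)`. -/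
def C0Semigroup.rescale (S : C0Semigroup X) (ν : ℂ) : C0Semigroup X where
  op t := Complex.exp (-ν * (t : ℝ)) • S.op t
  op_zero := by simp [S.op_zero]
  op_add s t := by
    ext x
    simp only [S.op_add, NNReal.coe_add, Complex.ofReal_add, mul_add, Complex.exp_add,
      ContinuousLinearMap.comp_apply, smul_apply, map_smul, smul_smul]
    rw [mul_comm]
  tendsto_zero x := by
    have h : Continuous fun t : ℝ≥0 => Complex.exp (-ν * (t : ℝ)) := by fun_prop
    simpa using ((h.tendsto 0).mono_left nhdsWithin_le_nhds).smul (S.tendsto_zero x)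

theorem rescale_op_apply (S : C0Semigroup X) (ν : ℂ) (t : ℝ≥0) (x : X) :
    (S.rescale ν).op t x = Complex.exp (-ν * (t : ℝ)) • S.op t x := rfl

theorem HasContinuousOrbits.rescale {S : C0Semigroup X} (hS : HasContinuousOrbits S) (ν : ℂ) :
    HasContinuousOrbits (S.rescale ν) := by
  intro x
  have h : Continuous fun t : ℝ≥0 => Complex.exp (-ν * (t : ℝ)) := by fun_prop
  exact h.smul (hS x)

theorem mem_generator_graph_rescale_of_mem {S : C0Semigroup X} {f g : X}
    (h : (f, g) ∈ (generator S.op).graph) (ν : ℂ) :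
    (f, g - ν • f) ∈ (generator (S.rescale ν).op).graph := by
  rw [mem_generator_graph_iff] at h ⊢
  have h1 : Continuous fun t : ℝ≥0 => Complex.exp (-ν * (t : ℝ)) := by fun_prop
  have h2 : Tendsto (fun t : ℝ≥0 => (((t : ℝ) : ℂ)⁻¹) • (Complex.exp (-ν * (t : ℝ)) - 1))
      (𝓝[>] 0) (𝓝 (-ν)) := by
    have hd : HasDerivAt (fun t : ℝ => Complex.exp (-ν * t)) (-ν) 0 := by
      have h3 : HasDerivAt (fun t : ℝ => -ν * (t : ℂ)) (-ν) 0 := by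
        simpa using ((hasDerivAt_id (0 : ℝ)).ofReal_comp).const_mul (-ν)
      simpa using h3.cexp
    simpa using tendsto_inv_smul_nnreal hd.hasDerivWithinAt
  have h3 := ((h1.tendsto 0).mono_left nhdsWithin_le_nhds).smul h
  have h4 := h3.add (h2.smul (tendsto_const_nhds (x := f)))
  simp only [NNReal.coe_zero, Complex.ofReal_zero, mul_zero, Complex.exp_zero, one_smul, neg_smul,
    ← sub_eq_add_neg] at h4
  refine h4.congr fun t => ?_
  rw [rescale_op_apply]
  module

theorem mem_generator_graph_rescale_iff {S : C0Semigroup X} {f g : X} (ν : ℂ) :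
    (f, g - ν • f) ∈ (generator (S.rescale ν).op).graph ↔ (f, g) ∈ (generator S.op).graph := by
  refine ⟨fun h => ?_, fun h => mem_generator_graph_rescale_of_mem h ν⟩
  have h1 := mem_generator_graph_rescale_of_mem h (-ν)
  have h2 : ((S.rescale ν).rescale (-ν)).op = S.op := by
    funext t
    ext x
    rw [rescale_op_apply, rescale_op_apply, smul_smul, ← Complex.exp_add]
    simp
  rw [h2] at h1
  simpa using h1

variable {S : C0Semigroup X}

theorem norm_rescale_op_le (hS : ∀ t, ‖S.op t‖ ≤ 1) (ν : ℂ) {r : ℝ} (hr : 0 ≤ r) (x : X) :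
    ‖(S.rescale ν).op r.toNNReal x‖ ≤ Real.exp (-ν.re * r) * ‖x‖ := by
  rw [rescale_op_apply, norm_smul, Complex.norm_exp]
  have h1 := (S.op r.toNNReal).le_of_opNorm_le (hS _) x
  rw [one_mul] at h1
  simp only [Real.coe_toNNReal _ hr, Complex.mul_re, Complex.neg_re, Complex.ofReal_re,
    Complex.ofReal_im, mul_zero, sub_zero]
  gcongr

theorem integrableOn_rescale_orbit (hS : ∀ t, ‖S.op t‖ ≤ 1) (hc : HasContinuousOrbits S) {ν : ℂ}
    (hν : 0 < ν.re) (x : X) :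
    IntegrableOn (fun r : ℝ => (S.rescale ν).op r.toNNReal x) (Ioi 0) := by
  refine Integrable.mono' ((integrableOn_exp_mul_Ioi (a := -ν.re) (by linarith) 0).mul_const ‖x‖)
    ((hc.rescale ν).comp_toNNReal x).aestronglyMeasurable ?_
  filter_upwards [ae_restrict_mem measurableSet_Ioi] with r hr
  exact norm_rescale_op_le hS ν (le_of_lt hr) x

/-- The Laplace transform `x ↦ ∫₀^∞ e^{-νr} S(r)x dr` of a contraction semigroup. -/
def laplaceTransform (hS : ∀ t, ‖S.op t‖ ≤ 1) (hc : HasContinuousOrbits S) {ν : ℂ}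
    (hν : 0 < ν.re) : X →L[ℂ] X :=
  LinearMap.mkContinuous
    { toFun := fun x => ∫ r in Ioi (0 : ℝ), (S.rescale ν).op r.toNNReal x
      map_add' := fun x y => by
        simp only [map_add]
        exact integral_add (integrableOn_rescale_orbit hS hc hν x)
          (integrableOn_rescale_orbit hS hc hν y)
      map_smul' := fun c x => by
        simp only [map_smul]
        exact integral_smul c _ }
    (∫ r in Ioi (0 : ℝ), Real.exp (-ν.re * r))
    (fun x => by
      rw [← integral_mul_const]
      refine norm_integral_le_of_norm_le
        ((integrableOn_exp_mul_Ioi (a := -ν.re) (by linarith) 0).mul_const ‖x‖) ?_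
      filter_upwards [ae_restrict_mem measurableSet_Ioi] with r hr
      exact norm_rescale_op_le hS ν (le_of_lt hr) x)

theorem laplaceTransform_apply (hS : ∀ t, ‖S.op t‖ ≤ 1) (hc : HasContinuousOrbits S) {ν : ℂ}
    (hν : 0 < ν.re) (x : X) :
    laplaceTransform hS hc hν x = ∫ r in Ioi (0 : ℝ), (S.rescale ν).op r.toNNReal x := rfl

variable [CompleteSpace X]

/-- For a contraction semigroup the Laplace transform at `ν`, `Re ν > 0`, is the resolvent of the
generator. -/
theorem isResolventAt_laplaceTransform (hS : ∀ t, ‖S.op t‖ ≤ 1) (hc : HasContinuousOrbits S)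
    {ν : ℂ} (hν : 0 < ν.re) :
    IsResolventAt (generator S.op) ν (laplaceTransform hS hc hν) := by
  constructor
  · intro x
    rw [← mem_generator_graph_rescale_iff ν, mem_generator_graph_iff_integral (hc.rescale ν)]
    intro h
    have hi := integrableOn_rescale_orbit hS hc hν x
    have h1 : (S.rescale ν).op h (laplaceTransform hS hc hν x) =
        ∫ r in Ioi (h : ℝ), (S.rescale ν).op r.toNNReal x := by
      rw [laplaceTransform_apply, ← ContinuousLinearMap.integral_comp_comm _ hi]
      have := (measurePreserving_add_right volume (h : ℝ)).setIntegral_preimage_emb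
        (measurableEmbedding_addRight (h : ℝ)) (fun r : ℝ => (S.rescale ν).op r.toNNReal x)
        (Ioi (h : ℝ))
      rw [preimage_add_const_Ioi, sub_self] at this
      rw [← this]
      refine setIntegral_congr_fun measurableSet_Ioi fun r hr => ?_
      exact (op_toNNReal_add _ h (le_of_lt hr) x).symm
    rw [h1, laplaceTransform_apply]
    have h2 := intervalIntegral.integral_Ioi_sub_Ioi hi (show (0 : ℝ) ≤ h from h.2)
    rw [sub_sub_cancel_left]
    simp only [orbitIntegral, map_neg, intervalIntegral.integral_neg]
    rw [← h2]
    abel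
  · intro q hq
    have h1 := (mem_generator_graph_rescale_iff ν).2 hq
    rw [mem_generator_graph_iff_integral (hc.rescale ν)] at h1
    have h2 := intervalIntegral_tendsto_integral_Ioi 0
      (integrableOn_rescale_orbit hS hc hν (q.2 - ν • q.1)) tendsto_id
    have h3 : Tendsto (fun t : ℝ => (S.rescale ν).op t.toNNReal q.1 - q.1) atTop
        (𝓝 (0 - q.1)) := by
      refine Tendsto.sub_const ?_ _
      refine squeeze_zero_norm' (a := fun t : ℝ => Real.exp (-ν.re * t) * ‖q.1‖) ?_ ?_
      · filter_upwards [eventually_ge_atTop 0] with t ht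
        exact norm_rescale_op_le hS ν ht _
      · rw [show (0 : ℝ) = 0 * ‖q.1‖ by simp]
        refine Tendsto.mul_const _ (Real.tendsto_exp_atBot.comp ?_)
        exact tendsto_id.const_mul_atTop_of_neg (by linarith)
    have h4 := tendsto_nhds_unique (h2.congr' ?_) h3
    · rw [laplaceTransform_apply]
      have : ν • q.1 - q.2 = -(q.2 - ν • q.1) := by abel
      rw [this]
      simp only [map_neg]
      rw [integral_neg, h4]
      abel
    · filter_upwards [eventually_ge_atTop 0] with t ht
      rw [h1 t.toNNReal, orbitIntegral, Real.coe_toNNReal _ ht]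
      rfl

end Rescaling

/-! ### The extrapolation space as an isometric copy of the original space -/

section Extrapolation

variable {X : Type*} [NormedAddCommGroup X] [NormedSpace ℂ X]
  {T : C0Semigroup X} {μ : ℂ}

theorem denseRange_toExtrapolation (T : C0Semigroup X) (μ : ℂ) :
    DenseRange (toExtrapolation T μ) :=
  UniformSpace.Completion.denseRange_coe (α := PreExtrapolation T μ)

variable [CompleteSpace X]

theorem denseRange_resolvent (hc : HasContinuousOrbits T)
    (hμ : μ ∈ resolventSet (generator T.op)) :
    DenseRange (resolvent (generator T.op) μ) := by
  refine (denseRange_fst_generator_graph hc).mono ?_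
  rintro _ ⟨q, rfl⟩
  exact ⟨_, (isResolventAt_resolvent hμ).2 q.1 q.2⟩

/-- The continuous extension of the resolvent `R(μ, A)` to an isometric isomorphism `X₋₁ ≃ X`. -/
def extrapolatedResolvent (hc : HasContinuousOrbits T)
    (hμ : μ ∈ resolventSet (generator T.op)) : Extrapolation T μ ≃ₗᵢ[ℂ] X :=
  let f : Extrapolation T μ →L[ℂ] X :=
    (resolvent (generator T.op) μ).toLinearMap.extendOfNorm (toExtrapolation T μ).toLinearMap
  have hf : ∀ x, f (toExtrapolation T μ x) = resolvent (generator T.op) μ x := fun x =>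
    LinearMap.extendOfNorm_eq (f := (resolvent (generator T.op) μ).toLinearMap)
      (e := (toExtrapolation T μ).toLinearMap) (denseRange_toExtrapolation T μ)
      ⟨1, fun y => by simp [norm_toExtrapolation]⟩ x
  have hn : ∀ a, ‖f a‖ = ‖a‖ := fun a =>
    (denseRange_toExtrapolation T μ).induction_on a (isClosed_eq (by fun_prop) (by fun_prop))
      (fun x => by rw [hf, norm_toExtrapolation])
  let g : Extrapolation T μ →ₗᵢ[ℂ] X := ⟨f.toLinearMap, hn⟩
  LinearIsometryEquiv.ofSurjective g (by
    have h1 : IsClosed (range g) := g.isometry.isClosedEmbedding.isClosed_range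
    rw [← range_eq_univ, ← h1.closure_eq]
    refine ((denseRange_resolvent hc hμ).mono ?_).closure_eq
    rintro _ ⟨x, rfl⟩
    exact ⟨_, hf x⟩)

theorem extrapolatedResolvent_toExtrapolation (hc : HasContinuousOrbits T)
    (hμ : μ ∈ resolventSet (generator T.op)) (x : X) :
    extrapolatedResolvent hc hμ (toExtrapolation T μ x) = resolvent (generator T.op) μ x :=
  LinearMap.extendOfNorm_eq (f := (resolvent (generator T.op) μ).toLinearMap)
    (e := (toExtrapolation T μ).toLinearMap) (denseRange_toExtrapolation T μ)
    ⟨1, fun y => by simp [norm_toExtrapolation]⟩ x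

theorem extrapolatedResolvent_extrapolatedOp (hc : HasContinuousOrbits T)
    (hμ : μ ∈ resolventSet (generator T.op)) (t : ℝ≥0) (a : Extrapolation T μ) :
    extrapolatedResolvent hc hμ (extrapolatedOp T μ t a) =
      T.op t (extrapolatedResolvent hc hμ a) := by
  refine (denseRange_toExtrapolation T μ).induction_on a (isClosed_eq (by fun_prop) (by fun_prop))
    fun x => ?_
  rw [extrapolatedOp_toExtrapolation, extrapolatedResolvent_toExtrapolation,
    extrapolatedResolvent_toExtrapolation, resolvent_commute]

/-- The isomorphism `X₋₁ ≃ X` intertwines `A₋₁` and `A`. -/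
theorem mem_extrapolatedGenerator_graph_iff (hc : HasContinuousOrbits T)
    (hμ : μ ∈ resolventSet (generator T.op)) (a b : Extrapolation T μ) :
    (a, b) ∈ (extrapolatedGenerator T μ).graph ↔
      (extrapolatedResolvent hc hμ a, extrapolatedResolvent hc hμ b) ∈
        (generator T.op).graph := by
  rw [extrapolatedGenerator, mem_generator_graph_iff, mem_generator_graph_iff,
    (extrapolatedResolvent hc hμ).toHomeomorph.isEmbedding.tendsto_nhds_iff]
  refine iff_of_eq (congrArg (fun F => Tendsto F _ _) ?_)
  funext h
  simp [extrapolatedResolvent_extrapolatedOp]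

/-- The resolvents of `A₋₁` are conjugate to those of `A`. -/
theorem isResolventAt_extrapolatedGenerator (hc : HasContinuousOrbits T)
    (hμ : μ ∈ resolventSet (generator T.op)) {ν : ℂ} {R : X →L[ℂ] X}
    (hR : IsResolventAt (generator T.op) ν R) :
    IsResolventAt (extrapolatedGenerator T μ) ν
      (((extrapolatedResolvent hc hμ).symm.toContinuousLinearEquiv : X →L[ℂ] Extrapolation T μ) ∘L
        R ∘L ((extrapolatedResolvent hc hμ).toContinuousLinearEquiv :
          Extrapolation T μ →L[ℂ] X)) := by
  constructor
  · intro a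
    rw [mem_extrapolatedGenerator_graph_iff hc hμ]
    simpa using hR.1 (extrapolatedResolvent hc hμ a)
  · rintro ⟨a, b⟩ hq
    rw [mem_extrapolatedGenerator_graph_iff hc hμ] at hq
    have := hR.2 _ hq
    simp only [← map_smul, ← map_sub] at this
    change (extrapolatedResolvent hc hμ).symm (R (extrapolatedResolvent hc hμ (ν • a - b))) = a
    rw [this, LinearIsometryEquiv.symm_apply_apply]

end Extrapolation

/-! ### Bochner integrals in `L¹` -/

section BochnerL1

variable {α β : Type*} [MeasurableSpace α] [MeasurableSpace β] {ν : Measure α} {m : Measure β}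
  [SigmaFinite m] {G : α → Lp ℂ 1 m} {k : α → β → ℂ}

theorem integrable_uncurry_of_ae_eq (hG : Integrable G ν)
    (hk : AEStronglyMeasurable (Function.uncurry k) (ν.prod m))
    (h : ∀ᵐ a ∂ν, G a =ᵐ[m] k a) : Integrable (Function.uncurry k) (ν.prod m) := by
  refine (integrable_prod_iff hk).2 ⟨?_, hG.norm.congr ?_⟩
  · filter_upwards [h] with a ha
    exact (L1.integrable_coeFn (G a)).congr ha
  · filter_upwards [h] with a ha
    rw [L1.norm_eq_integral_norm]
    refine integral_congr_ae ?_
    filter_upwards [ha] with b hb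
    rw [hb]
    rfl

/-- A Bochner integral in `L¹` is computed pointwise almost everywhere. -/
theorem coeFn_integral_ae_eq [SFinite ν] (hG : Integrable G ν)
    (hk : AEStronglyMeasurable (Function.uncurry k) (ν.prod m))
    (h : ∀ᵐ a ∂ν, G a =ᵐ[m] k a) :
    (∫ a, G a ∂ν : Lp ℂ 1 m) =ᵐ[m] fun b => ∫ a, k a b ∂ν := by
  have hki := integrable_uncurry_of_ae_eq hG hk h
  refine (L1.integrable_coeFn _).ae_eq_of_forall_setIntegral_eq _ _ hki.integral_prod_right
    fun s hs _ => ?_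
  let ℓ : Lp ℂ 1 m →L[ℝ] ℂ :=
    (L1.integralCLM (α := β) (E := ℂ) (μ := m.restrict s)).comp (LpToLpRestrictCLM β ℂ ℝ m 1 s)
  have hℓ : ∀ f : Lp ℂ 1 m, ℓ f = ∫ b in s, f b ∂m := by
    intro f
    change L1.integralCLM (LpToLpRestrictCLM β ℂ ℝ m 1 s f) = _
    rw [← L1.integral_eq, L1.integral_eq_integral]
    exact integral_congr_ae (LpToLpRestrictCLM_coeFn ℝ s f)
  rw [← hℓ, ← ContinuousLinearMap.integral_comp_comm _ hG]
  have h1 : ∀ᵐ a ∂ν, ℓ (G a) = ∫ b in s, k a b ∂m := by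
    filter_upwards [h] with a ha
    rw [hℓ]
    exact integral_congr_ae (ae_restrict_of_ae ha)
  rw [integral_congr_ae h1]
  refine integral_integral_swap ?_
  refine hki.mono_measure ?_
  exact Measure.prod_mono le_rfl Measure.restrict_le_self

end BochnerL1

/-! ### The generator of the left translation semigroup and its spectrum -/

section TranslationFacts

theorem continuous_translation (f : Lp ℂ 1 (volume : Measure ℝ)) :
    Continuous fun t : ℝ => translation t f := by
  let g : ℝ → C(ℝ, ℝ) := fun t => ⟨fun s => s + t, by fun_prop⟩
  have hg : Continuous g := ContinuousMap.continuous_of_continuous_uncurry _ (by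
    change Continuous fun q : ℝ × ℝ => q.2 + q.1
    fun_prop)
  exact Continuous.compMeasurePreservingLp (continuous_const (y := f)) hg
    (fun t => measurePreserving_add_right volume t) ENNReal.one_ne_top

theorem norm_translation_le (t : ℝ) : ‖translation t‖ ≤ 1 :=
  LinearIsometry.norm_toContinuousLinearMap_le _

theorem norm_restrict_le (s : Set ℝ) : ‖LpToLpRestrictCLM ℝ ℂ ℂ volume 1 s‖ ≤ 1 :=
  LinearMap.mkContinuous_norm_le _ zero_le_one _

theorem norm_zeroExtension_le : ‖zeroExtension‖ ≤ 1 :=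
  LinearMap.mkContinuous_norm_le _ zero_le_one _

theorem norm_leftTranslation_op_le (t : ℝ≥0) : ‖leftTranslation.op t‖ ≤ 1 := by
  refine (ContinuousLinearMap.opNorm_comp_le _ _).trans
    (mul_le_one₀ (norm_restrict_le _) (norm_nonneg _) ?_)
  exact (ContinuousLinearMap.opNorm_comp_le _ _).trans
    (mul_le_one₀ (norm_translation_le _) (norm_nonneg _) norm_zeroExtension_le)

theorem hasContinuousOrbits_leftTranslation : HasContinuousOrbits leftTranslation := fun f =>
  (LpToLpRestrictCLM ℝ ℂ ℂ volume 1 (Iic (0 : ℝ))).continuous.comp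
    ((continuous_translation (zeroExtension f)).comp NNReal.continuous_coe)

theorem stronglyMeasurable_indicator_coe (g : L1Neg) :
    StronglyMeasurable ((Iic (0 : ℝ)).indicator g) :=
  (Lp.stronglyMeasurable g).indicator measurableSet_Iic

theorem integrable_indicator_coe (g : L1Neg) :
    Integrable ((Iic (0 : ℝ)).indicator g) volume :=
  memLp_one_iff_integrable.1 (memLp_zeroExtension g)

theorem coeFn_integral_rescale_leftTranslation (ν : ℂ) (g : L1Neg) (h : ℝ≥0) :
    (orbitIntegral (leftTranslation.rescale ν) h g : L1Neg)
      =ᵐ[volume.restrict (Iic (0 : ℝ))]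
        fun s : ℝ => ∫ r in (0 : ℝ)..h,
          Complex.exp (-ν * r) * (Iic (0 : ℝ)).indicator g (s + r) := by
  rw [orbitIntegral]
  simp only [intervalIntegral.integral_of_le h.coe_nonneg]
  refine coeFn_integral_ae_eq
    (k := fun r s : ℝ => Complex.exp (-ν * r) * (Iic (0 : ℝ)).indicator g (s + r)) ?_ ?_ ?_
  · exact (((hasContinuousOrbits_leftTranslation.rescale ν).comp_toNNReal g).intervalIntegrable
      0 h).1
  · refine StronglyMeasurable.aestronglyMeasurable ?_
    refine StronglyMeasurable.mul ?_ ?_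
    · exact Continuous.stronglyMeasurable (by fun_prop)
    · exact (stronglyMeasurable_indicator_coe g).comp_measurable
        (measurable_snd.add measurable_fst)
  · filter_upwards [ae_restrict_mem measurableSet_Ioc] with r hr
    have h1 := leftTranslationOp_coeFn r.toNNReal g
    have h2 := Lp.coeFn_smul (Complex.exp (-ν * ((r.toNNReal : ℝ≥0) : ℝ)))
      (leftTranslation.op r.toNNReal g)
    filter_upwards [h1, h2] with s h1 h2
    rw [rescale_op_apply, h2, Pi.smul_apply, smul_eq_mul]
    rw [Real.coe_toNNReal _ hr.1.le] at h1 ⊢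
    exact congrArg _ h1

theorem integral_indicator_Iic_eq {F : ℝ → ℂ} {s b : ℝ} (hs : s ≤ 0) (hb : 0 ≤ b)
    (k : ℝ → ℂ) :
    ∫ x in s..b, k x * (Iic (0 : ℝ)).indicator F x = ∫ x in s..0, k x * F x := by
  rw [intervalIntegral.integral_of_le (hs.trans hb), intervalIntegral.integral_of_le hs]
  have h1 : (fun x => k x * (Iic (0 : ℝ)).indicator F x) =
      (Iic (0 : ℝ)).indicator fun x => k x * F x := by
    funext x
    by_cases hx : x ∈ Iic (0 : ℝ) <;> simp [hx]
  rw [h1, setIntegral_indicator measurableSet_Iic, Ioc_inter_Iic, min_eq_right hb]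

/-- Variation of constants for `f' = g`, written as `f' = νf + (g - νf)` and `f(0) = 0`. -/
theorem coeFn_eq_of_mem_generator_graph {f g : L1Neg}
    (h : (f, g) ∈ (generator leftTranslation.op).graph) (ν : ℂ) :
    f =ᵐ[volume.restrict (Iic (0 : ℝ))]
      fun s => -∫ y in s..0, Complex.exp (ν * (s - y)) * (g - ν • f) y := by
  rw [← mem_generator_graph_rescale_iff ν,
    mem_generator_graph_iff_integral (hasContinuousOrbits_leftTranslation.rescale ν)] at h
  have key : ∀ n : ℕ, ∀ᵐ s ∂volume.restrict (Iic (0 : ℝ)),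
      Complex.exp (-ν * n) * (Iic (0 : ℝ)).indicator f (s + n) - f s =
        ∫ r in (0 : ℝ)..n,
          Complex.exp (-ν * r) * (Iic (0 : ℝ)).indicator (g - ν • f : L1Neg) (s + r) := by
    intro n
    have h0 := h n
    have h1 := coeFn_integral_rescale_leftTranslation ν (g - ν • f) n
    rw [← h0] at h1
    have h2 := Lp.coeFn_sub ((leftTranslation.rescale ν).op n f) f
    have h3 := Lp.coeFn_smul (Complex.exp (-ν * ((n : ℝ≥0) : ℝ))) (leftTranslation.op n f)
    have h4 := leftTranslationOp_coeFn n f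
    filter_upwards [h1, h2, h3, h4] with s h1 h2 h3 h4
    rw [h2, Pi.sub_apply, rescale_op_apply, h3, Pi.smul_apply, smul_eq_mul] at h1
    simp only [NNReal.coe_natCast, Complex.ofReal_natCast] at h1 h4
    rw [← h1]
    congr 2
    exact h4.symm
  filter_upwards [ae_all_iff.2 key, ae_restrict_mem measurableSet_Iic] with s hs hs0
  -- translating by `n > -s` moves the point `s` out of `ℝ₋`, so the term with `T(n)f` vanishes
  obtain ⟨n, hn⟩ := exists_nat_gt (-s)
  have h1 := hs n
  rw [indicator_of_notMem (by simp; linarith), mul_zero, zero_sub] at h1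
  rw [← neg_neg (f s), h1]
  congr 1
  have h2 := intervalIntegral.integral_comp_add_left (a := 0) (b := (n : ℝ))
    (fun y : ℝ => Complex.exp (ν * (s - y)) * (Iic (0 : ℝ)).indicator (g - ν • f : L1Neg) y) s
  rw [add_zero, integral_indicator_Iic_eq hs0 (by linarith)] at h2
  rw [← h2]
  refine intervalIntegral.integral_congr fun r _ => ?_
  simp only [Complex.ofReal_add]
  congr 2
  ring

theorem intervalIntegral_congr_of_ae_Iic {f g : ℝ → ℂ}
    (h : f =ᵐ[volume.restrict (Iic (0 : ℝ))] g) {s : ℝ} (hs : s ≤ 0) :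
    ∫ r in s..0, f r = ∫ r in s..0, g r := by
  rw [intervalIntegral.integral_of_le hs, intervalIntegral.integral_of_le hs]
  exact integral_congr_ae (ae_restrict_of_ae_restrict_of_subset Ioc_subset_Iic_self h)

theorem intervalIntegrable_coe (g : L1Neg) {s : ℝ} (hs : s ≤ 0) :
    IntervalIntegrable g volume s 0 := by
  rw [intervalIntegrable_iff_integrableOn_Ioc_of_le hs]
  exact IntegrableOn.mono_set (L1.integrable_coeFn g) Ioc_subset_Iic_self

theorem IsW11.add {f g f' g' : L1Neg} {c c' : ℂ} (h : IsW11 f g c) (h' : IsW11 f' g' c') :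
    IsW11 (f + f') (g + g') (c + c') := by
  unfold IsW11 at h h' ⊢
  filter_upwards [h, h', Lp.coeFn_add f f', ae_restrict_mem measurableSet_Iic] with s h h' hf hs
  rw [hf, Pi.add_apply, h, h', intervalIntegral_congr_of_ae_Iic (Lp.coeFn_add g g') hs]
  simp only [Pi.add_apply]
  rw [intervalIntegral.integral_add (intervalIntegrable_coe g hs) (intervalIntegrable_coe g' hs)]
  ring

theorem IsW11.smul {f g : L1Neg} {c : ℂ} (h : IsW11 f g c) (a : ℂ) :
    IsW11 (a • f) (a • g) (a * c) := by
  unfold IsW11 at h ⊢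
  filter_upwards [h, Lp.coeFn_smul a f, ae_restrict_mem measurableSet_Iic] with s h hf hs
  rw [hf, Pi.smul_apply, h, intervalIntegral_congr_of_ae_Iic (Lp.coeFn_smul a g) hs]
  simp only [Pi.smul_apply, smul_eq_mul]
  rw [intervalIntegral.integral_const_mul]
  ring

/-- The primitive formula for `f` persists on all of `ℝ` after extension by zero, since `f(0) = 0`. -/
theorem IsW11.indicator_ae_eq {f g : L1Neg} (h : IsW11 f g 0) :
    (Iic (0 : ℝ)).indicator f =ᵐ[volume] fun x => -∫ y in x..0, (Iic (0 : ℝ)).indicator g y := by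
  have h1 := (ae_eq_restrict_iff_indicator_ae_eq measurableSet_Iic).1 h
  refine h1.trans (Eventually.of_forall fun x => ?_)
  have h2 := fun hx : x ≤ 0 => integral_indicator_Iic_eq (F := g) hx le_rfl (fun _ => 1)
  simp only [one_mul] at h2
  beta_reduce
  by_cases hx : x ≤ 0
  · rw [indicator_of_mem (show x ∈ Iic (0 : ℝ) from hx), zero_sub, h2 hx]
  · rw [indicator_of_notMem (show x ∉ Iic (0 : ℝ) from hx), intervalIntegral.integral_symm, neg_neg,
      intervalIntegral.integral_of_le (le_of_not_ge hx)]
    symm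
    refine setIntegral_eq_zero_of_forall_eq_zero fun y hy => ?_
    exact indicator_of_notMem (by simpa using hy.1) _

/-- The generator of the left translation semigroup is `f ↦ f'` on
`{f ∈ W^{1,1}(ℝ₋) : f(0) = 0}`. -/
theorem mem_generator_leftTranslation_iff (f g : L1Neg) :
    (f, g) ∈ (generator leftTranslation.op).graph ↔ IsW11 f g 0 := by
  constructor
  · intro h
    unfold IsW11
    simpa using coeFn_eq_of_mem_generator_graph h 0
  · intro h
    rw [← mem_generator_graph_rescale_iff 0,
      mem_generator_graph_iff_integral (hasContinuousOrbits_leftTranslation.rescale 0)]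
    intro t
    rw [zero_smul, sub_zero]
    apply Lp.ext
    have h1 := h.indicator_ae_eq
    have h2 := (measurePreserving_add_right volume (t : ℝ)).quasiMeasurePreserving.ae_eq_comp h1
    have h3 : (leftTranslation.rescale 0).op t f = leftTranslationOp t f := by
      rw [rescale_op_apply]
      simp only [neg_zero, zero_mul, Complex.exp_zero, one_smul]
      rfl
    rw [h3]
    symm
    filter_upwards [coeFn_integral_rescale_leftTranslation 0 g t, ae_restrict_of_ae h1,
      ae_restrict_of_ae h2, leftTranslationOp_coeFn t f, Lp.coeFn_sub (leftTranslationOp t f) f,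
      ae_restrict_mem measurableSet_Iic] with s h4 h5 h6 h7 h8 hs
    rw [indicator_of_mem hs] at h5
    simp only [Function.comp_apply] at h6
    rw [h4, h8, Pi.sub_apply, h7, h6, h5]
    simp only [neg_zero, zero_mul, Complex.exp_zero, one_mul]
    have hi : ∀ a b, IntervalIntegrable ((Iic (0 : ℝ)).indicator g) volume a b :=
      fun a b => (integrable_indicator_coe g).intervalIntegrable
    rw [intervalIntegral.integral_comp_add_left (fun x => (Iic (0 : ℝ)).indicator g x), add_zero,
      ← intervalIntegral.integral_add_adjacent_intervals (hi s 0) (hi 0 (s + t)),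
      intervalIntegral.integral_symm (s + t : ℝ) 0]
    ring

theorem norm_exp_mul_ofReal (ν : ℂ) (s : ℝ) : ‖Complex.exp (ν * s)‖ = Real.exp (ν.re * s) := by
  simp [Complex.norm_exp]

theorem resolventSet_leftTranslation :
    resolventSet (generator leftTranslation.op) = {ν : ℂ | 0 < ν.re} := by
  ext ν
  constructor
  · rintro ⟨R, hR⟩
    by_contra hν
    simp only [mem_ofPred_eq, not_lt] at hν
    -- the solution of `νf - f' = x` with `f(0) = 0` equals `e^{ν·}` to the left of the support of
    -- this `x`, so it is not integrable
    let x₀ : ℝ → ℂ := (Icc (-1 : ℝ) 0).indicator fun s => Complex.exp (ν * s)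
    have hx₀ : MemLp x₀ 1 (volume.restrict (Iic (0 : ℝ))) := by
      rw [memLp_one_iff_integrable]
      refine Integrable.integrableOn ?_
      rw [integrable_indicator_iff measurableSet_Icc]
      exact (Continuous.continuousOn (by fun_prop)).integrableOn_compact isCompact_Icc
    let x : L1Neg := hx₀.toLp x₀
    have h1 := coeFn_eq_of_mem_generator_graph (hR.1 x) ν
    have h2 : ∀ᵐ s ∂volume.restrict (Iic (-1 : ℝ)), ‖(1 : ℂ)‖ ≤ ‖R x s‖ := by
      have h3 := ae_restrict_of_ae_restrict_of_subset (Iic_subset_Iic.2 (by norm_num)) h1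
        (s := Iic (-1 : ℝ))
      filter_upwards [h3, ae_restrict_mem measurableSet_Iic] with s hs hs1
      have hs1' : s ≤ -1 := hs1
      have h4 : (fun y : ℝ => Complex.exp (ν * (s - y)) * (ν • R x - x - ν • R x : L1Neg) y)
          =ᵐ[volume.restrict (Iic (0 : ℝ))]
            fun y => (Icc (-1 : ℝ) 0).indicator (fun _ => -Complex.exp (ν * s)) y := by
        have h5 : ν • R x - x - ν • R x = -x := by abel
        rw [h5]
        filter_upwards [Lp.coeFn_neg x, hx₀.coeFn_toLp] with y h6 h7
        rw [h6, Pi.neg_apply, h7]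
        by_cases hy : y ∈ Icc (-1 : ℝ) 0
        · simp only [x₀, indicator_of_mem hy, mul_neg, ← Complex.exp_add]
          congr 2
          ring
        · simp only [x₀, indicator_of_notMem hy, neg_zero, mul_zero]
      have h8 : R x s = Complex.exp (ν * s) := by
        rw [hs, intervalIntegral_congr_of_ae_Iic h4 (by linarith),
          intervalIntegral.integral_of_le (by linarith),
          setIntegral_congr_set (Ioc_ae_eq_Icc (α := ℝ)),
          setIntegral_indicator measurableSet_Icc, Icc_inter_Icc, max_eq_right hs1', min_self]
        simp
      rw [h8, norm_exp_mul_ofReal, norm_one]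
      exact Real.one_le_exp (mul_nonneg_of_nonpos_of_nonpos hν (by linarith))
    have h3 : IntegrableOn (fun _ : ℝ => (1 : ℂ)) (Iic (-1 : ℝ)) := by
      refine Integrable.mono (g := fun s => R x s) ?_ aestronglyMeasurable_const h2
      exact IntegrableOn.mono_set (L1.integrable_coeFn (R x)) (Iic_subset_Iic.2 (by norm_num))
    rw [integrableOn_const_iff (by simp)] at h3
    simp at h3
  · exact fun hν => ⟨_, isResolventAt_laplaceTransform norm_leftTranslation_op_le
      hasContinuousOrbits_leftTranslation hν⟩

end TranslationFacts

/-! ### The Dirichlet operators -/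

section Dirichlet

variable {ν : ℂ}

theorem memLp_exp (hν : 0 < ν.re) :
    MemLp (fun s : ℝ => Complex.exp (ν * s)) 1 (volume.restrict (Iic (0 : ℝ))) := by
  rw [memLp_one_iff_integrable]
  exact integrableOn_exp_mul_complex_Iic hν 0

/-- The operator `c ↦ c e^{ν·}`. -/
def dirichlet (hν : 0 < ν.re) : ℂ →L[ℂ] L1Neg :=
  ContinuousLinearMap.toSpanSingleton ℂ ((memLp_exp hν).toLp _)

theorem dirichlet_coeFn (hν : 0 < ν.re) (c : ℂ) :
    dirichlet hν c =ᵐ[volume.restrict (Iic (0 : ℝ))] fun s => c * Complex.exp (ν * s) := by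
  rw [dirichlet, ContinuousLinearMap.toSpanSingleton_apply]
  filter_upwards [Lp.coeFn_smul c ((memLp_exp hν).toLp _), (memLp_exp hν).coeFn_toLp] with s h1 h2
  rw [h1, Pi.smul_apply, h2, smul_eq_mul]

theorem isW11_dirichlet (hν : 0 < ν.re) (c : ℂ) :
    IsW11 (dirichlet hν c) (ν • dirichlet hν c) c := by
  have h0 : ν ≠ 0 := by
    rintro rfl
    simp at hν
  unfold IsW11
  filter_upwards [dirichlet_coeFn hν c, ae_restrict_mem measurableSet_Iic] with s hs hs0
  have h1 : (ν • dirichlet hν c : L1Neg) =ᵐ[volume.restrict (Iic (0 : ℝ))]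
      fun r : ℝ => ν * c * Complex.exp (ν * r) := by
    filter_upwards [Lp.coeFn_smul ν (dirichlet hν c), dirichlet_coeFn hν c] with r h1 h2
    rw [h1, Pi.smul_apply, h2, smul_eq_mul, mul_assoc]
  rw [hs, intervalIntegral_congr_of_ae_Iic h1 hs0, intervalIntegral.integral_const_mul,
    integral_exp_mul_complex h0]
  simp only [Complex.ofReal_zero, mul_zero, Complex.exp_zero]
  field_simp
  ring

/-- `W^{1,1}`-solutions of `f' = νf` are determined by their value at `0`, since `ν ∈ ρ(A)`. -/
theorem isDirichletOperator_dirichlet (hν : 0 < ν.re) :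
    IsDirichletOperator ν (dirichlet hν) := by
  intro c f
  constructor
  · rintro rfl
    exact isW11_dirichlet hν c
  · intro hf
    have h1 := hf.add ((isW11_dirichlet hν c).smul (-1))
    have h2 : (f + (-1 : ℂ) • dirichlet hν c, ν • (f + (-1 : ℂ) • dirichlet hν c)) ∈
        (generator leftTranslation.op).graph := by
      rw [mem_generator_leftTranslation_iff]
      convert h1 using 1
      · rw [smul_add, smul_comm]
      · ring
    have h3 := (isResolventAt_laplaceTransform norm_leftTranslation_op_le
      hasContinuousOrbits_leftTranslation hν).2 _ h2
    simp only [sub_self, map_zero] at h3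
    have h4 : f - dirichlet hν c = 0 := by
      rw [h3]
      module
    exact (sub_eq_zero.1 h4).symm

end Dirichlet

/-! ### Extension by zero -/

section ExtendByZero

variable {J : Set ℝ}

theorem memLp_indicator_coe (hJ : MeasurableSet J) (f : Lp ℂ 1 (volume.restrict J)) :
    MemLp (J.indicator f) 1 (volume : Measure ℝ) :=
  (memLp_indicator_iff_restrict hJ).2 (Lp.memLp f)

/-- Extension by zero `L¹(J) → L¹(ℝ)`. -/
def extendByZero (hJ : MeasurableSet J) :
    Lp ℂ 1 (volume.restrict J) →L[ℂ] Lp ℂ 1 (volume : Measure ℝ) :=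
  LinearMap.mkContinuous
    { toFun := fun f => (memLp_indicator_coe hJ f).toLp (J.indicator f)
      map_add' := fun f g => by
        rw [← MemLp.toLp_add]
        refine MemLp.toLp_congr _ _ ?_
        rw [← indicator_add']
        exact (ae_eq_restrict_iff_indicator_ae_eq hJ).1 (Lp.coeFn_add f g)
      map_smul' := fun c f => by
        rw [RingHom.id_apply, ← MemLp.toLp_const_smul]
        refine MemLp.toLp_congr _ _ ?_
        refine ((ae_eq_restrict_iff_indicator_ae_eq hJ).1 (Lp.coeFn_smul c f)).trans
          (Eventually.of_forall fun s => ?_)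
        by_cases hs : s ∈ J <;> simp [hs] }
    1
    (fun f => by
      change ‖(memLp_indicator_coe hJ f).toLp (J.indicator f)‖ ≤ _
      rw [one_mul, Lp.norm_toLp, eLpNorm_indicator_eq_eLpNorm_restrict hJ, Lp.norm_def])

theorem extendByZero_coeFn (hJ : MeasurableSet J) (f : Lp ℂ 1 (volume.restrict J)) :
    extendByZero hJ f =ᵐ[volume] J.indicator f :=
  MemLp.coeFn_toLp (memLp_indicator_coe hJ f)

theorem norm_extendByZero_le (hJ : MeasurableSet J) : ‖extendByZero hJ‖ ≤ 1 :=
  LinearMap.mkContinuous_norm_le _ zero_le_one _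

end ExtendByZero

/-! ### The control operator and the control maps -/

section Control

variable {μ ν : ℂ}

/-- The control operator `B`: the operator corresponding to the Dirichlet operator `D_μ` under the
isomorphism `X₋₁ ≃ X` given by the extrapolated resolvent at `μ`. -/
def controlOperator (hμ : μ ∈ resolventSet (generator leftTranslation.op)) (h0 : 0 < μ.re) :
    ℂ →L[ℂ] Extrapolation leftTranslation μ :=
  ((extrapolatedResolvent hasContinuousOrbits_leftTranslation hμ).symm.toContinuousLinearEquiv :
    L1Neg →L[ℂ] Extrapolation leftTranslation μ) ∘L dirichlet h0

theorem extrapolatedResolvent_controlOperator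
    (hμ : μ ∈ resolventSet (generator leftTranslation.op)) (h0 : 0 < μ.re) (c : ℂ) :
    extrapolatedResolvent hasContinuousOrbits_leftTranslation hμ (controlOperator hμ h0 c) =
      dirichlet h0 c :=
  LinearIsometryEquiv.apply_symm_apply _ _

/-- Both sides belong to `W^{1,1}(ℝ₋)`, solve `f' = μf` and have the value `c` at `0`. -/
theorem dirichlet_eq_add_resolvent (hμ : μ ∈ resolventSet (generator leftTranslation.op))
    (h0 : 0 < μ.re) (hν : 0 < ν.re) (c : ℂ) :
    dirichlet h0 c = dirichlet hν c +
      (ν - μ) • resolvent (generator leftTranslation.op) μ (dirichlet hν c) := by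
  rw [isDirichletOperator_dirichlet h0 c]
  have h1 := (mem_generator_leftTranslation_iff _ _).1
    ((isResolventAt_resolvent hμ).1 (dirichlet hν c))
  convert (isW11_dirichlet hν c).add (h1.smul (ν - μ)) using 1
  · module
  · ring

/-- The operator `B = (ν - A₋₁) D_ν` does not depend on `ν`. -/
theorem isBoundaryControl_controlOperator
    (hμ : μ ∈ resolventSet (generator leftTranslation.op)) (h0 : 0 < μ.re) (hν : 0 < ν.re) :
    IsBoundaryControl leftTranslation μ ν (dirichlet hν) (controlOperator hμ h0) := by
  intro c
  set e := extrapolatedResolvent hasContinuousOrbits_leftTranslation hμ with he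
  set R := resolvent (generator leftTranslation.op) μ with hR
  refine ⟨e.symm (μ • R (dirichlet hν c) - dirichlet hν c), ?_, ?_⟩
  · rw [mem_extrapolatedGenerator_graph_iff hasContinuousOrbits_leftTranslation hμ, ← he,
      e.apply_symm_apply, he, extrapolatedResolvent_toExtrapolation]
    exact (isResolventAt_resolvent hμ).1 _
  · apply e.injective
    rw [map_sub, map_smul, e.apply_symm_apply, he, extrapolatedResolvent_toExtrapolation,
      extrapolatedResolvent_controlOperator, dirichlet_eq_add_resolvent hμ h0 hν]
    module

/-- The control map `L¹(0,t) → L¹(ℝ₋)`: extension by zero followed by translation by `t`. -/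
def controlMap (t : ℝ) : Lp ℂ 1 (volume.restrict (Ioc 0 t)) →L[ℂ] L1Neg :=
  (LpToLpRestrictCLM ℝ ℂ ℂ volume 1 (Iic (0 : ℝ))).comp
    ((translation t).comp (extendByZero measurableSet_Ioc))

theorem norm_controlMap_le (t : ℝ) : ‖controlMap t‖ ≤ 1 := by
  refine (ContinuousLinearMap.opNorm_comp_le _ _).trans
    (mul_le_one₀ (norm_restrict_le _) (norm_nonneg _) ?_)
  exact (ContinuousLinearMap.opNorm_comp_le _ _).trans
    (mul_le_one₀ (norm_translation_le _) (norm_nonneg _) (norm_extendByZero_le _))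

theorem controlMap_coeFn (t : ℝ) (u : Lp ℂ 1 (volume.restrict (Ioc 0 t))) :
    controlMap t u =ᵐ[volume.restrict (Iic (0 : ℝ))] fun s => (Ioc 0 t).indicator u (s + t) := by
  have h1 := LpToLpRestrictCLM_coeFn ℂ (Iic (0 : ℝ))
    (translation t (extendByZero measurableSet_Ioc u))
  have h2 := ae_restrict_of_ae (s := Iic (0 : ℝ))
    (translation_coeFn t (extendByZero measurableSet_Ioc u))
  have h3 := ae_restrict_of_ae (s := Iic (0 : ℝ))
    ((measurePreserving_add_right volume t).quasiMeasurePreserving.ae_eq_comp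
      (extendByZero_coeFn measurableSet_Ioc u))
  filter_upwards [h1, h2, h3] with s h1 h2 h3
  exact h1.trans (h2.trans h3)

theorem controlMap_coeFn_ite (t : ℝ) (u : Lp ℂ 1 (volume.restrict (Ioc 0 t))) :
    controlMap t u =ᵐ[volume.restrict (Iic (0 : ℝ))]
      fun s => if -t < s then u (s + t) else 0 := by
  filter_upwards [controlMap_coeFn t u, ae_restrict_mem measurableSet_Iic] with s h hs
  rw [h, indicator_apply]
  have hs' : s ≤ 0 := hs
  refine if_congr ?_ rfl rfl
  rw [mem_Ioc]
  constructor
  · rintro ⟨h1, -⟩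
    linarith
  · intro h1
    exact ⟨by linarith, by linarith⟩

/-- The resolvent of the left translation semigroup in integral form. -/
theorem resolvent_leftTranslation_coeFn
    (hμ : μ ∈ resolventSet (generator leftTranslation.op)) (v : L1Neg) :
    resolvent (generator leftTranslation.op) μ v =ᵐ[volume.restrict (Iic (0 : ℝ))]
      fun s => ∫ y in s..0, Complex.exp (μ * (s - y)) * v y := by
  filter_upwards [coeFn_eq_of_mem_generator_graph ((isResolventAt_resolvent hμ).1 v) μ,
    ae_restrict_mem measurableSet_Iic] with s hs hs0
  rw [hs, ← intervalIntegral.integral_neg]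
  refine intervalIntegral_congr_of_ae_Iic ?_ hs0
  rw [sub_sub_cancel_left]
  filter_upwards [Lp.coeFn_neg v] with y hy
  rw [hy, Pi.neg_apply, mul_neg, neg_neg]

theorem leftTranslation_dirichlet_coeFn (h0 : 0 < μ.re) (c : ℂ) {τ : ℝ} (hτ : 0 ≤ τ) :
    leftTranslation.op τ.toNNReal (dirichlet h0 c) =ᵐ[volume.restrict (Iic (0 : ℝ))]
      fun s => c * (Iic (0 : ℝ)).indicator (fun z : ℝ => Complex.exp (μ * z)) (s + τ) := by
  have h1 := leftTranslationOp_coeFn τ.toNNReal (dirichlet h0 c)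
  have h2 := (measurePreserving_add_right volume τ).quasiMeasurePreserving.ae_eq_comp
    ((ae_eq_restrict_iff_indicator_ae_eq measurableSet_Iic).1 (dirichlet_coeFn h0 c))
  filter_upwards [h1, ae_restrict_of_ae h2] with s h1 h2
  rw [Real.coe_toNNReal _ hτ] at h1
  refine h1.trans (h2.trans ?_)
  simp only [Function.comp_apply, indicator_apply]
  split_ifs <;> simp

/-- The convolution integral, seen through the isomorphism `X₋₁ ≃ X`, is `R(μ, A)` applied to the
control map. At `s` both sides are the integral of `e^{μ(s+t-x)} u(x)` over
`x ∈ (0,t]` with `x > s + t`. -/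
theorem integral_leftTranslation_dirichlet
    (hμ : μ ∈ resolventSet (generator leftTranslation.op)) (h0 : 0 < μ.re) {t : ℝ}
    (u : Lp ℂ 1 (volume.restrict (Ioc 0 t))) :
    (∫ x in Ioc 0 t, leftTranslation.op (t - x).toNNReal (dirichlet h0 (u x)) : L1Neg) =
      resolvent (generator leftTranslation.op) μ (controlMap t u) := by
  have hG : Integrable (fun x => leftTranslation.op (t - x).toNNReal (dirichlet h0 (u x)))
      (volume.restrict (Ioc 0 t)) := by
    have h1 : (fun x => leftTranslation.op (t - x).toNNReal (dirichlet h0 (u x))) =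
        fun x => u x • leftTranslation.op (t - x).toNNReal (dirichlet h0 1) := by
      funext x
      rw [← map_smul, ← map_smul, smul_eq_mul, mul_one]
    rw [h1]
    refine Integrable.mono' (g := fun x => ‖u x‖ * ‖dirichlet h0 1‖)
      ((L1.integrable_coeFn u).norm.mul_const ‖dirichlet h0 1‖) ?_ ?_
    · have hc : Continuous fun x : ℝ => leftTranslation.op (t - x).toNNReal (dirichlet h0 1) :=
        (hasContinuousOrbits_leftTranslation.comp_toNNReal _).comp (continuous_sub_left t)
      exact (Lp.aestronglyMeasurable u).smul hc.aestronglyMeasurable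
    · refine Eventually.of_forall fun x => ?_
      rw [norm_smul]
      gcongr
      simpa using (leftTranslation.op (t - x).toNNReal).le_of_opNorm_le
        (norm_leftTranslation_op_le _) (dirichlet h0 1)
  have h1 := coeFn_integral_ae_eq (k := fun x s : ℝ =>
    u x * (Iic (0 : ℝ)).indicator (fun z : ℝ => Complex.exp (μ * z)) (s + (t - x))) hG ?_ ?_
  rotate_left
  · refine StronglyMeasurable.aestronglyMeasurable (StronglyMeasurable.mul ?_ ?_)
    · exact (Lp.stronglyMeasurable u).comp_measurable measurable_fst
    · have hexp : Continuous fun z : ℝ => Complex.exp (μ * z) := by fun_prop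
      exact (hexp.stronglyMeasurable.indicator measurableSet_Iic).comp_measurable
        (measurable_snd.add (measurable_const.sub measurable_fst))
  · filter_upwards [ae_restrict_mem measurableSet_Ioc] with x hx
    exact leftTranslation_dirichlet_coeFn h0 (u x) (sub_nonneg.2 hx.2)
  apply Lp.ext
  filter_upwards [h1, resolvent_leftTranslation_coeFn hμ (controlMap t u),
    ae_restrict_mem measurableSet_Iic] with s h1 h2 hs
  have hs' : s ≤ 0 := hs
  refine h1.trans (Eq.trans ?_ h2.symm)
  have h3 : (fun y : ℝ => Complex.exp (μ * (s - y)) * controlMap t u y)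
      =ᵐ[volume.restrict (Iic (0 : ℝ))]
        fun y : ℝ => Complex.exp (μ * (s + t - (y + t : ℝ))) * (Ioc 0 t).indicator u (y + t) := by
    filter_upwards [controlMap_coeFn t u] with y hy
    rw [hy]
    congr 3
    push_cast
    ring
  rw [intervalIntegral_congr_of_ae_Iic h3 hs', intervalIntegral.integral_comp_add_right
    (fun y : ℝ => Complex.exp (μ * (s + t - y)) * (Ioc 0 t).indicator u y), zero_add,
    intervalIntegral.integral_of_le (by linarith)]
  have h4 : (fun y : ℝ => Complex.exp (μ * (s + t - y)) * (Ioc 0 t).indicator u y) =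
      (Ioc 0 t).indicator fun y : ℝ => Complex.exp (μ * (s + t - y)) * u y := by
    funext y
    by_cases hy : y ∈ Ioc 0 t
    · simp only [indicator_of_mem hy]
    · simp only [indicator_of_notMem hy, mul_zero]
  have h5 : (fun x : ℝ => u x *
      (Iic (0 : ℝ)).indicator (fun z : ℝ => Complex.exp (μ * z)) (s + (t - x))) =
      (Ici (s + t)).indicator fun y : ℝ => Complex.exp (μ * (s + t - y)) * u y := by
    funext x
    have h6 : s + (t - x) ∈ Iic (0 : ℝ) ↔ x ∈ Ici (s + t) := by
      simp only [mem_Iic, mem_Ici]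
      constructor <;> intro h <;> linarith
    by_cases hx : x ∈ Ici (s + t)
    · rw [indicator_of_mem (h6.2 hx), indicator_of_mem hx, mul_comm]
      congr 3
      push_cast
      ring
    · rw [indicator_of_notMem (fun h => hx (h6.1 h)), indicator_of_notMem hx, mul_zero]
  rw [h4, h5, setIntegral_indicator measurableSet_Ioc, setIntegral_indicator measurableSet_Ici]
  refine setIntegral_congr_set ?_
  have h7 : Ioc (s + t) t ∩ Ioc 0 t = Ioc 0 t ∩ Ioi (s + t) := by
    ext x
    simp only [mem_inter_iff, mem_Ioc, mem_Ioi]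
    tauto
  rw [h7]
  exact (ae_eq_refl _).inter Ioi_ae_eq_Ici.symm

/-- The convolution integral is represented by the control map. -/
theorem toExtrapolation_controlMap (hμ : μ ∈ resolventSet (generator leftTranslation.op))
    (h0 : 0 < μ.re) {t : ℝ} (ht : 0 < t) (u : Lp ℂ 1 (volume.restrict (Ioc 0 t))) :
    toExtrapolation leftTranslation μ (controlMap t u) =
      convolution leftTranslation μ (controlOperator hμ h0) u t := by
  apply (extrapolatedResolvent hasContinuousOrbits_leftTranslation hμ).injective
  rw [extrapolatedResolvent_toExtrapolation, ← integral_leftTranslation_dirichlet hμ h0,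
    convolution, intervalIntegral.integral_of_le ht.le]
  refine Eq.trans ?_ (LinearIsometry.integral_comp_comm
    (extrapolatedResolvent hasContinuousOrbits_leftTranslation hμ).toLinearIsometry _)
  refine integral_congr_ae (Eventually.of_forall fun x => ?_)
  simp only [LinearIsometryEquiv.coe_toLinearIsometry]
  rw [extrapolatedResolvent_extrapolatedOp, extrapolatedResolvent_controlOperator]

theorem convolution_congr {T : C0Semigroup L1Neg} (B : ℂ →L[ℂ] Extrapolation T μ) {t : ℝ}
    (ht : 0 ≤ t) {u v : ℝ → ℂ} (h : u =ᵐ[volume.restrict (Ioc 0 t)] v) :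
    convolution T μ B u t = convolution T μ B v t := by
  rw [convolution, convolution, intervalIntegral.integral_of_le ht,
    intervalIntegral.integral_of_le ht]
  refine integral_congr_ae ?_
  filter_upwards [h] with x hx
  rw [hx]

theorem toExtrapolation_controlMap_toLp (hμ : μ ∈ resolventSet (generator leftTranslation.op))
    (h0 : 0 < μ.re) {t : ℝ} (ht : 0 < t) {u : ℝ → ℂ} (hu : MemLp u 1 (volume.restrict (Ioc 0 t))) :
    toExtrapolation leftTranslation μ (controlMap t (hu.toLp u)) =
      convolution leftTranslation μ (controlOperator hμ h0) u t := by
  rw [toExtrapolation_controlMap hμ h0 ht]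
  exact convolution_congr _ ht.le hu.coeFn_toLp

theorem isInfiniteTimeAdmissibleControl_controlOperator
    (hμ : μ ∈ resolventSet (generator leftTranslation.op)) (h0 : 0 < μ.re) :
    IsInfiniteTimeAdmissibleControl leftTranslation μ (controlOperator hμ h0) 1 :=
  ⟨1, zero_le_one, fun _ ht u => ⟨_, toExtrapolation_controlMap hμ h0 ht u,
    (controlMap _).le_of_opNorm_le (norm_controlMap_le _) u⟩⟩

theorem isAdmissibleControl_controlOperator
    (hμ : μ ∈ resolventSet (generator leftTranslation.op)) (h0 : 0 < μ.re) :
    IsAdmissibleControl leftTranslation μ (controlOperator hμ h0) 1 :=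
  ⟨1, one_pos, fun _ hu => ⟨_, toExtrapolation_controlMap_toLp hμ h0 one_pos hu⟩⟩

end Control

/-! ### The space `L¹(ℝ₋) ∩ C₀(ℝ₋)` and compatibility -/

section IntermediateSpace

/-- The restriction to `ℝ₋` of a continuous function on `ℝ` which vanishes at `-∞`. -/
def c0OfTendsto (W : ℝ → ℂ) (hW : Continuous W) (h0 : Tendsto W atBot (𝓝 0)) :
    C₀(Iic (0 : ℝ), ℂ) where
  toFun s := W s
  continuous_toFun := hW.comp continuous_subtype_val
  zero_at_infty' := by
    refine h0.comp ?_
    rw [tendsto_atBot]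
    intro b
    change _ ∈ cocompact _
    rw [mem_cocompact]
    refine ⟨Subtype.val ⁻¹' Icc b 0, ?_, ?_⟩
    · exact isClosed_Iic.isClosedEmbedding_subtypeVal.isCompact_preimage isCompact_Icc
    · intro s hs
      simp only [mem_compl_iff, mem_preimage, mem_Icc, not_and_or] at hs
      exact hs.elim (fun h => (not_le.1 h).le) (fun h => absurd s.2 h)

theorem isClosed_l1CapC0 : IsClosed (l1CapC0 : Set (L1Neg × C₀(Iic (0 : ℝ), ℂ))) := by
  rw [← isSeqClosed_iff_isClosed]
  intro q p hq hp
  have h1 : Tendsto (fun n => (q n).1) atTop (𝓝 p.1) := (continuous_fst.tendsto p).comp hp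
  have h2 : Tendsto (fun n => (q n).2) atTop (𝓝 p.2) := (continuous_snd.tendsto p).comp hp
  obtain ⟨ns, hns, h3⟩ := (tendstoInMeasure_of_tendsto_Lp h1).exists_seq_tendsto_ae
  have h4 : ∀ n, ∀ᵐ s ∂(volume.restrict (Iic (0 : ℝ))), ∀ hs : s ∈ Iic (0 : ℝ),
    (q n).1 s = (q n).2 ⟨s, hs⟩ := hq
  change ∀ᵐ s ∂(volume.restrict (Iic (0 : ℝ))), ∀ hs : s ∈ Iic (0 : ℝ), p.1 s = p.2 ⟨s, hs⟩
  filter_upwards [h3, ae_all_iff.2 h4] with s h3 h4 hs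
  have h5 : Tendsto (fun n => (q (ns n)).2 ⟨s, hs⟩) atTop (𝓝 (p.2 ⟨s, hs⟩)) := by
    have h6 := h2.comp hns.tendsto_atTop
    rw [tendsto_iff_dist_tendsto_zero] at h6 ⊢
    refine squeeze_zero (fun _ => dist_nonneg) (fun n => ?_) h6
    exact BoundedContinuousFunction.dist_coe_le_dist
      (f := ((q (ns n)).2).toBCF) (g := p.2.toBCF) (⟨s, hs⟩ : Iic (0 : ℝ))
  refine tendsto_nhds_unique (h3.congr fun n => ?_) h5
  exact h4 (ns n) hs

theorem injective_l1CapC0ToL1 : Function.Injective l1CapC0ToL1 := by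
  rintro ⟨⟨f, g⟩, h⟩ ⟨⟨f', g'⟩, h'⟩ hff
  have hff' : f = f' := hff
  subst hff'
  have h1 : ∀ᵐ s ∂(volume.restrict (Iic (0 : ℝ))), ∀ hs : s ∈ Iic (0 : ℝ),
    f s = g ⟨s, hs⟩ := h
  have h2 : ∀ᵐ s ∂(volume.restrict (Iic (0 : ℝ))), ∀ hs : s ∈ Iic (0 : ℝ),
    f s = g' ⟨s, hs⟩ := h'
  let p : ℝ → Iic (0 : ℝ) := fun s => ⟨min s 0, min_le_right s 0⟩
  have hp : Continuous p := Continuous.subtype_mk (by fun_prop) _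
  have hp' : ∀ s (hs : s ∈ Iic (0 : ℝ)), p s = ⟨s, hs⟩ := fun s hs =>
    Subtype.ext (min_eq_left hs)
  have h3 := Measure.eqOn_of_ae_eq (μ := (volume : Measure ℝ)) (s := Iic (0 : ℝ))
    (f := g ∘ p) (g := g' ∘ p) ?_
    (g.continuous.comp hp).continuousOn (g'.continuous.comp hp).continuousOn (by simp)
  · have : g = g' := by
      ext s
      simpa [hp' s.1 s.2] using h3 s.2
    subst this
    rfl
  · filter_upwards [h1, h2, ae_restrict_mem measurableSet_Iic] with s h1 h2 hs
    rw [Function.comp_apply, Function.comp_apply, hp' s hs, ← h1 hs, ← h2 hs]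

/-- The resolvent of `A₋₁` at the base point `μ` maps `B c` to `D_μ c = c e^{μ·}`, which is continuous
and vanishes at `-∞`. -/
theorem isCompatible_controlOperator {μ : ℂ}
    (hμ : μ ∈ resolventSet (generator leftTranslation.op)) (h0 : 0 < μ.re) :
    IsCompatible (Z := l1CapC0) leftTranslation μ l1CapC0ToL1 (controlOperator hμ h0) := by
  have hR := isResolventAt_extrapolatedGenerator hasContinuousOrbits_leftTranslation hμ
    (isResolventAt_resolvent hμ)
  refine ⟨μ, hμ, ⟨_, hR⟩, fun c => ?_⟩
  have hW : Tendsto (fun s : ℝ => c * Complex.exp (μ * s)) atBot (𝓝 0) := by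
    rw [tendsto_zero_iff_norm_tendsto_zero]
    simp only [norm_mul, norm_exp_mul_ofReal]
    rw [← mul_zero ‖c‖]
    exact (Real.tendsto_exp_atBot.comp (tendsto_id.const_mul_atBot h0)).const_mul _
  refine ⟨⟨(dirichlet h0 c, c0OfTendsto _ (by fun_prop) hW), ?_⟩, ?_⟩
  · filter_upwards [dirichlet_coeFn h0 c] with s hs _
    exact hs
  · rw [hR.resolvent_eq]
    apply (extrapolatedResolvent hasContinuousOrbits_leftTranslation hμ).injective
    rw [extrapolatedResolvent_toExtrapolation]
    simp only [ContinuousLinearMap.comp_apply]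
    refine (LinearIsometryEquiv.apply_symm_apply _ _).trans ?_
    congr 1
    exact extrapolatedResolvent_controlOperator hμ h0 c

end IntermediateSpace

/-! ### Primitives of integrable functions and their translates -/

section Primitive

/-- The primitive `x ↦ ∫_{-∞}^x G` of an integrable function. -/
def primitive (G : Lp ℂ 1 (volume : Measure ℝ)) (x : ℝ) : ℂ := ∫ y in Iic x, G y

theorem primitive_sub_primitive (G : Lp ℂ 1 (volume : Measure ℝ)) (a b : ℝ) :
    primitive G b - primitive G a = ∫ y in a..b, G y :=
  intervalIntegral.integral_Iic_sub_Iic (L1.integrable_coeFn G).integrableOn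
    (L1.integrable_coeFn G).integrableOn

theorem primitive_congr {G : Lp ℂ 1 (volume : Measure ℝ)} {F : ℝ → ℂ} (h : G =ᵐ[volume] F)
    (x : ℝ) : primitive G x = ∫ y in Iic x, F y :=
  integral_congr_ae (ae_restrict_of_ae h)

theorem primitive_add (G G' : Lp ℂ 1 (volume : Measure ℝ)) (x : ℝ) :
    primitive (G + G') x = primitive G x + primitive G' x := by
  rw [primitive_congr (Lp.coeFn_add G G')]
  exact integral_add (L1.integrable_coeFn G).integrableOn (L1.integrable_coeFn G').integrableOn

theorem primitive_smul (c : ℂ) (G : Lp ℂ 1 (volume : Measure ℝ)) (x : ℝ) :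
    primitive (c • G) x = c * primitive G x := by
  rw [primitive_congr (Lp.coeFn_smul c G)]
  exact integral_const_mul c _

theorem norm_primitive_le (G : Lp ℂ 1 (volume : Measure ℝ)) (x : ℝ) :
    ‖primitive G x‖ ≤ ‖G‖ := by
  rw [L1.norm_eq_integral_norm]
  refine (norm_integral_le_integral_norm _).trans ?_
  exact setIntegral_le_integral (L1.integrable_coeFn G).norm
    (Eventually.of_forall fun _ => norm_nonneg _)

/-- Uniform continuity follows from the absolute continuity of the integral. -/
theorem uniformContinuous_primitive (G : Lp ℂ 1 (volume : Measure ℝ)) :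
    UniformContinuous (primitive G) := by
  rw [EMetric.uniformContinuous_iff]
  intro ε hε
  obtain ⟨δ, hδ, h⟩ := exists_pos_setLIntegral_lt_of_measure_lt
    (L1.integrable_coeFn G).2.ne hε.ne'
  refine ⟨δ, hδ, fun {a b} hab => ?_⟩
  wlog hle : a ≤ b generalizing a b
  · rw [edist_comm]
    exact this (by rwa [edist_comm]) (le_of_not_ge hle)
  have h1 : volume (Ioc a b) < δ := by
    rw [Real.volume_Ioc]
    rwa [edist_comm, edist_dist, Real.dist_eq, abs_of_nonneg (sub_nonneg.2 hle)] at hab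
  rw [edist_comm, edist_eq_enorm_sub, primitive_sub_primitive, intervalIntegral.integral_of_le hle]
  exact (enorm_integral_le_lintegral_enorm _).trans_lt (h _ h1)

theorem tendsto_primitive_atBot (G : Lp ℂ 1 (volume : Measure ℝ)) :
    Tendsto (primitive G) atBot (𝓝 0) :=
  tendsto_integral_Iic_zero tendsto_id

/-- The function `σ ↦ W(σ + r)` on `ℝ₋`, where `W` is the primitive of `G`. -/
def shiftedPrimitive (G : Lp ℂ 1 (volume : Measure ℝ)) (r : ℝ) : C₀(Iic (0 : ℝ), ℂ) :=
  c0OfTendsto (fun s => primitive G (s + r))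
    ((uniformContinuous_primitive G).continuous.comp (continuous_add_const r))
    ((tendsto_primitive_atBot G).comp (tendsto_atBot_add_const_right _ r tendsto_id))

theorem shiftedPrimitive_apply (G : Lp ℂ 1 (volume : Measure ℝ)) (r : ℝ) (s : Iic (0 : ℝ)) :
    shiftedPrimitive G r s = primitive G (s + r) := rfl

theorem shiftedPrimitive_add (G G' : Lp ℂ 1 (volume : Measure ℝ)) (r : ℝ) :
    shiftedPrimitive (G + G') r = shiftedPrimitive G r + shiftedPrimitive G' r := by
  ext s
  exact primitive_add G G' _

theorem shiftedPrimitive_smul (c : ℂ) (G : Lp ℂ 1 (volume : Measure ℝ)) (r : ℝ) :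
    shiftedPrimitive (c • G) r = c • shiftedPrimitive G r := by
  ext s
  exact primitive_smul c G _

theorem norm_c0_le {f : C₀(Iic (0 : ℝ), ℂ)} {M : ℝ} (hM : 0 ≤ M) (h : ∀ s, ‖f s‖ ≤ M) :
    ‖f‖ ≤ M := by
  rw [← ZeroAtInftyContinuousMap.norm_toBCF_eq_norm]
  exact (BoundedContinuousFunction.norm_le hM).2 h

theorem norm_c0_apply_le (f : C₀(Iic (0 : ℝ), ℂ)) (s : Iic (0 : ℝ)) : ‖f s‖ ≤ ‖f‖ := by
  rw [← ZeroAtInftyContinuousMap.norm_toBCF_eq_norm]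
  exact f.toBCF.norm_coe_le_norm s

theorem norm_shiftedPrimitive_le (G : Lp ℂ 1 (volume : Measure ℝ)) (r : ℝ) :
    ‖shiftedPrimitive G r‖ ≤ ‖G‖ :=
  norm_c0_le (norm_nonneg _) fun _ => norm_primitive_le G _

theorem continuous_shiftedPrimitive (G : Lp ℂ 1 (volume : Measure ℝ)) :
    Continuous (shiftedPrimitive G) := by
  refine UniformContinuous.continuous (Metric.uniformContinuous_iff.2 fun ε hε => ?_)
  obtain ⟨δ, hδ, h⟩ := Metric.uniformContinuous_iff.1 (uniformContinuous_primitive G) (ε / 2)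
    (half_pos hε)
  refine ⟨δ, hδ, fun {a b} hab => ?_⟩
  rw [dist_eq_norm]
  refine (norm_c0_le (half_pos hε).le fun s => ?_).trans_lt (half_lt_self hε)
  have h1 := h (a := s + a) (b := s + b) (by rwa [dist_add_left])
  rw [dist_eq_norm] at h1
  exact h1.le

end Primitive

/-! ### Functionals on `C₀(ℝ₋)` applied to families of functions -/

section Duality

/-- Evaluation at a point as a continuous linear functional. -/
def evalC0 (s : Iic (0 : ℝ)) : C₀(Iic (0 : ℝ), ℂ) →L[ℂ] ℂ :=
  LinearMap.mkContinuous
    { toFun := fun f => f s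
      map_add' := fun _ _ => rfl
      map_smul' := fun _ _ => rfl } 1
    (fun f => by simpa using norm_c0_apply_le f s)

theorem evalC0_apply (s : Iic (0 : ℝ)) (f : C₀(Iic (0 : ℝ), ℂ)) : evalC0 s f = f s := rfl

variable (C : C₀(Iic (0 : ℝ), ℂ) →L[ℂ] ℂ) {z : ℝ → C₀(Iic (0 : ℝ), ℂ)} {K : Set ℝ} {N : ℝ≥0∞}

/-- The duality estimate for a family which is Bochner integrable with values in `C₀(ℝ₋)`. -/
theorem lintegral_enorm_functional_le_of_integrableOn (hz : IntegrableOn z K) (hN : N ≠ ∞)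
    (h : ∀ s, ∫⁻ r in K, ‖z r s‖ₑ ≤ N) :
    ∫⁻ r in K, ‖C (z r)‖ₑ ≤ ENNReal.ofReal ‖C‖ * N := by
  -- `a r` is the unimodular factor that turns `C (z r)` into its absolute value, so that the
  -- left-hand side is `C (∫ a • z)`, and the function `∫ a • z` is bounded by `N`
  let a : ℝ → ℂ := fun r => (C (z r))⁻¹ * (‖C (z r)‖ : ℂ)
  have hCz : Integrable (fun r => C (z r)) (volume.restrict K) := C.integrable_comp hz
  have ha1 : ∀ r, ‖a r‖ ≤ 1 := by
    intro r
    simp only [a, norm_mul, norm_inv, Complex.norm_real, norm_norm]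
    exact inv_mul_le_one
  have ha2 : ∀ r, a r * C (z r) = (‖C (z r)‖ : ℂ) := by
    intro r
    by_cases h0 : C (z r) = 0
    · simp [a, h0]
    · simp only [a]
      field_simp
  have ham : AEStronglyMeasurable a (volume.restrict K) := by
    have h1 := hCz.aestronglyMeasurable.aemeasurable
    exact (h1.inv.mul (Complex.measurable_ofReal.comp_aemeasurable h1.norm)).aestronglyMeasurable
  have haz : Integrable (fun r => a r • z r) (volume.restrict K) := by
    refine hz.norm.mono' (ham.smul hz.aestronglyMeasurable) (Eventually.of_forall fun r => ?_)
    rw [norm_smul]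
    exact mul_le_of_le_one_left (norm_nonneg _) (ha1 r)
  have hY : ‖∫ r in K, a r • z r‖ ≤ N.toReal := by
    refine norm_c0_le ENNReal.toReal_nonneg fun s => ?_
    rw [← evalC0_apply, ← ContinuousLinearMap.integral_comp_comm _ haz]
    refine (norm_integral_le_lintegral_norm _).trans (ENNReal.toReal_mono hN ?_)
    refine le_trans (lintegral_mono fun r => ?_) (h s)
    rw [ofReal_norm, map_smul, evalC0_apply, smul_eq_mul]
    rw [← ofReal_norm, ← ofReal_norm, norm_mul]
    exact ENNReal.ofReal_le_ofReal (mul_le_of_le_one_left (norm_nonneg _) (ha1 r))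
  have hCY : ((∫ r in K, ‖C (z r)‖ : ℝ) : ℂ) = C (∫ r in K, a r • z r) := by
    rw [← ContinuousLinearMap.integral_comp_comm _ haz, ← integral_complex_ofReal]
    refine integral_congr_ae (Eventually.of_forall fun r => ?_)
    simp only [map_smul, smul_eq_mul, ha2]
  rw [← ofReal_integral_norm_eq_lintegral_enorm hCz]
  calc ENNReal.ofReal (∫ r in K, ‖C (z r)‖) ≤ ENNReal.ofReal (‖C‖ * N.toReal) := by
        refine ENNReal.ofReal_le_ofReal ?_
        calc ∫ r in K, ‖C (z r)‖ ≤ ‖((∫ r in K, ‖C (z r)‖ : ℝ) : ℂ)‖ := by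
              rw [Complex.norm_real]
              exact le_abs_self _
          _ ≤ ‖C‖ * ‖∫ r in K, a r • z r‖ := by
              rw [hCY]
              exact C.le_opNorm _
          _ ≤ ‖C‖ * N.toReal := by gcongr
    _ = ENNReal.ofReal ‖C‖ * N := by
        rw [ENNReal.ofReal_mul C.opNorm_nonneg, ENNReal.ofReal_toReal hN]

/-- If `∫_K |z(r)(s)| dr ≤ N` for all `s`, then `∫_K |C z(r)| dr ≤ ‖C‖ N`. By duality this needs no
representation of `C` by a measure. The family is only assumed to be continuous: on an unbounded set
it need not be integrable in the supremum norm. -/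
theorem lintegral_enorm_functional_le (hz : Continuous z) (hN : N ≠ ∞)
    (h : ∀ s, ∫⁻ r in K, ‖z r s‖ₑ ≤ N) :
    ∫⁻ r in K, ‖C (z r)‖ₑ ≤ ENNReal.ofReal ‖C‖ * N := by
  -- on bounded sets the family is Bochner integrable
  have h1 : K = ⋃ n : ℕ, K ∩ Icc (-(n : ℝ)) n := by
    rw [← inter_iUnion]
    symm
    refine inter_eq_left.2 fun x _ => ?_
    obtain ⟨n, hn⟩ := exists_nat_ge |x|
    exact mem_iUnion.2 ⟨n, abs_le.1 hn⟩
  have h2 : Directed (· ⊆ ·) fun n : ℕ => K ∩ Icc (-(n : ℝ)) n := by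
    refine Monotone.directed_le fun m n hmn => inter_subset_inter_right _ ?_
    have : (m : ℝ) ≤ n := Nat.cast_le.2 hmn
    exact Icc_subset_Icc (neg_le_neg this) this
  rw [h1, setLIntegral_iUnion_of_directed _ h2]
  refine iSup_le fun n => lintegral_enorm_functional_le_of_integrableOn C ?_ hN fun s =>
    (lintegral_mono_set inter_subset_left).trans (h s)
  exact (hz.continuousOn.integrableOn_compact isCompact_Icc).mono_set inter_subset_right

end Duality

/-! ### The output operator on `L¹` -/

section ObservationOperator

/-- The pairs `(ψ, G)` of integrable functions on `ℝ` such that `ψ` is the primitive of `G` on the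
set `L`. -/
def primitiveGraph (L : Set ℝ) :
    Submodule ℂ (Lp ℂ 1 (volume : Measure ℝ) × Lp ℂ 1 (volume : Measure ℝ)) where
  carrier := {q | q.1 =ᵐ[volume.restrict L] primitive q.2}
  zero_mem' := by
    change ((0 : Lp ℂ 1 (volume : Measure ℝ)) : ℝ → ℂ) =ᵐ[volume.restrict L] primitive 0
    filter_upwards [ae_restrict_of_ae (Lp.coeFn_zero ℂ 1 (volume : Measure ℝ))] with x hx
    rw [hx, ← zero_smul ℂ (0 : Lp ℂ 1 (volume : Measure ℝ)), primitive_smul, zero_mul]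
    rfl
  add_mem' := by
    intro a b ha hb
    filter_upwards [ha, hb, ae_restrict_of_ae (Lp.coeFn_add a.1 b.1)] with x h1 h2 h3
    rw [Prod.fst_add, Prod.snd_add, h3, Pi.add_apply, h1, h2, primitive_add]
  smul_mem' := by
    intro c a ha
    filter_upwards [ha, ae_restrict_of_ae (Lp.coeFn_smul c a.1)] with x h1 h2
    rw [Prod.smul_fst, Prod.smul_snd, h2, Pi.smul_apply, h1, primitive_smul, smul_eq_mul]

variable (C : C₀(Iic (0 : ℝ), ℂ) →L[ℂ] ℂ) {K L : Set ℝ}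

theorem enorm_restrict_eq (L : Set ℝ) (ψ : Lp ℂ 1 (volume : Measure ℝ)) :
    ‖LpToLpRestrictCLM ℝ ℂ ℂ volume 1 L ψ‖ₑ = ∫⁻ x in L, ‖ψ x‖ₑ := by
  rw [Lp.enorm_def, eLpNorm_one_eq_lintegral_enorm]
  refine lintegral_congr_ae ?_
  filter_upwards [LpToLpRestrictCLM_coeFn ℂ L ψ] with x hx
  rw [hx]

/-- Since `L` is a lower set containing `K`, the translates `K + s`, `s ≤ 0`, stay inside `L`. -/
theorem lintegral_shiftedPrimitive_le (hK : MeasurableSet K) (hL : MeasurableSet L)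
    (hlow : IsLowerSet L) (hKL : K ⊆ L) (q : primitiveGraph L) (s : Iic (0 : ℝ)) :
    ∫⁻ r in K, ‖shiftedPrimitive q.1.2 r s‖ₑ ≤
      ‖LpToLpRestrictCLM ℝ ℂ ℂ volume 1 L q.1.1‖ₑ := by
  have hq : q.1.1 =ᵐ[volume.restrict L] primitive q.1.2 := q.2
  rw [enorm_restrict_eq, ← lintegral_indicator hK]
  calc ∫⁻ r, K.indicator (fun r => ‖shiftedPrimitive q.1.2 r s‖ₑ) r
      ≤ ∫⁻ r, L.indicator (fun x => ‖primitive q.1.2 x‖ₑ) (s + r) := by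
        refine lintegral_mono fun r => ?_
        by_cases hr : r ∈ K
        · have hsr : (s : ℝ) + r ∈ L := hlow (add_le_of_nonpos_left s.2) (hKL hr)
          rw [indicator_of_mem hr, indicator_of_mem hsr]
          rfl
        · rw [indicator_of_notMem hr]
          exact zero_le
    _ = ∫⁻ x, L.indicator (fun x => ‖primitive q.1.2 x‖ₑ) x := lintegral_add_left_eq_self _ _
    _ = ∫⁻ x in L, ‖q.1.1 x‖ₑ := by
        rw [lintegral_indicator hL]
        refine lintegral_congr_ae ?_
        filter_upwards [hq] with x hx
        rw [hx]

theorem continuous_functional_shiftedPrimitive (G : Lp ℂ 1 (volume : Measure ℝ)) :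
    Continuous fun r => C (shiftedPrimitive G r) :=
  C.continuous.comp (continuous_shiftedPrimitive G)

theorem lintegral_functional_shiftedPrimitive_le (hK : MeasurableSet K) (hL : MeasurableSet L)
    (hlow : IsLowerSet L) (hKL : K ⊆ L) (q : primitiveGraph L) :
    ∫⁻ r in K, ‖C (shiftedPrimitive q.1.2 r)‖ₑ ≤
      ENNReal.ofReal ‖C‖ * ‖LpToLpRestrictCLM ℝ ℂ ℂ volume 1 L q.1.1‖ₑ :=
  lintegral_enorm_functional_le C (continuous_shiftedPrimitive _) enorm_ne_top
    (lintegral_shiftedPrimitive_le hK hL hlow hKL q)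

theorem memLp_functional_shiftedPrimitive (hK : MeasurableSet K) (hL : MeasurableSet L)
    (hlow : IsLowerSet L) (hKL : K ⊆ L) (q : primitiveGraph L) :
    MemLp (fun r => C (shiftedPrimitive q.1.2 r)) 1 (volume.restrict K) := by
  refine ⟨(continuous_functional_shiftedPrimitive C _).aestronglyMeasurable, ?_⟩
  rw [eLpNorm_one_eq_lintegral_enorm]
  exact (lintegral_functional_shiftedPrimitive_le C hK hL hlow hKL q).trans_lt
    (ENNReal.mul_lt_top ENNReal.ofReal_lt_top enorm_lt_top)

/-- The map `(ψ, G) ↦ (r ↦ C (ψ(· + r)))` on primitives. -/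
def observationLinear (hK : MeasurableSet K) (hL : MeasurableSet L)
    (hlow : IsLowerSet L) (hKL : K ⊆ L) :
    primitiveGraph L →ₗ[ℂ] Lp ℂ 1 (volume.restrict K) where
  toFun q := (memLp_functional_shiftedPrimitive C hK hL hlow hKL q).toLp _
  map_add' q q' := by
    rw [← MemLp.toLp_add]
    refine MemLp.toLp_congr _ _ (Eventually.of_forall fun r => ?_)
    simp only [Submodule.coe_add, Prod.snd_add, shiftedPrimitive_add, map_add, Pi.add_apply]
  map_smul' c q := by
    rw [RingHom.id_apply, ← MemLp.toLp_const_smul]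
    refine MemLp.toLp_congr _ _ (Eventually.of_forall fun r => ?_)
    simp only [Submodule.coe_smul, Prod.smul_snd, shiftedPrimitive_smul, map_smul, Pi.smul_apply]

/-- The restriction to `L` of the first component. -/
def restrictFst (L : Set ℝ) : primitiveGraph L →ₗ[ℂ] Lp ℂ 1 (volume.restrict L) :=
  ((LpToLpRestrictCLM ℝ ℂ ℂ volume 1 L).toLinearMap ∘ₗ LinearMap.fst ℂ _ _) ∘ₗ
    (primitiveGraph L).subtype

theorem norm_observationLinear_le (hK : MeasurableSet K) (hL : MeasurableSet L)
    (hlow : IsLowerSet L) (hKL : K ⊆ L) (q : primitiveGraph L) :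
    ‖observationLinear C hK hL hlow hKL q‖ ≤ ‖C‖ * ‖restrictFst L q‖ := by
  change ‖(memLp_functional_shiftedPrimitive C hK hL hlow hKL q).toLp _‖ ≤ _
  rw [Lp.norm_toLp, eLpNorm_one_eq_lintegral_enorm]
  refine ENNReal.toReal_le_of_le_ofReal (by positivity) ?_
  rw [ENNReal.ofReal_mul C.opNorm_nonneg, ofReal_norm (restrictFst L q)]
  exact lintegral_functional_shiftedPrimitive_le C hK hL hlow hKL q

/-- The right translation semigroup on `L¹(ℝ)`. -/
def rightTranslation : C0Semigroup (Lp ℂ 1 (volume : Measure ℝ)) where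
  op t := translation (-(t : ℝ))
  op_zero := by
    ext1 f
    apply Lp.ext
    simpa using translation_coeFn 0 f
  op_add s t := by
    ext1 f
    apply Lp.ext
    have h1 := (measurePreserving_add_right volume (-(s : ℝ))).quasiMeasurePreserving.ae_eq_comp
      (translation_coeFn (-(t : ℝ)) f)
    filter_upwards [translation_coeFn (-((s + t : ℝ≥0) : ℝ)) f,
      translation_coeFn (-(s : ℝ)) (translation (-(t : ℝ)) f), h1] with x h2 h3 h4
    rw [h2, ContinuousLinearMap.comp_apply, h3]
    refine Eq.trans ?_ h4.symm
    simp only [Function.comp_apply, NNReal.coe_add]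
    congr 1
    ring
  tendsto_zero f := by
    have h0 : translation 0 f = f := by
      apply Lp.ext
      simpa using translation_coeFn 0 f
    have h1 : Continuous fun t : ℝ≥0 => translation (-(t : ℝ)) f :=
      (continuous_translation f).comp NNReal.continuous_coe.neg
    have h2 := h1.tendsto 0
    simp only [NNReal.coe_zero, neg_zero, h0] at h2
    exact h2.mono_left nhdsWithin_le_nhds

theorem hasContinuousOrbits_rightTranslation : HasContinuousOrbits rightTranslation := fun f =>
  (continuous_translation f).comp NNReal.continuous_coe.neg

/-- Orbit integrals of the right translation semigroup are primitives: at `s` the value is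
`∫_{s-h}^s φ`. -/
theorem orbitIntegral_rightTranslation_coeFn (h : ℝ≥0) (φ : Lp ℂ 1 (volume : Measure ℝ)) :
    (orbitIntegral rightTranslation h φ : Lp ℂ 1 (volume : Measure ℝ)) =ᵐ[volume]
      primitive (φ - translation (-(h : ℝ)) φ) := by
  have h1 : (orbitIntegral rightTranslation h φ : Lp ℂ 1 (volume : Measure ℝ)) =ᵐ[volume]
      fun s => ∫ r in (0 : ℝ)..h, φ (s - r) := by
    rw [orbitIntegral]
    simp only [intervalIntegral.integral_of_le h.coe_nonneg]
    refine coeFn_integral_ae_eq (k := fun r s : ℝ => φ (s - r)) ?_ ?_ ?_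
    · exact ((hasContinuousOrbits_rightTranslation.comp_toNNReal φ).intervalIntegrable 0 h).1
    · exact ((Lp.stronglyMeasurable φ).comp_measurable
        (measurable_snd.sub measurable_fst)).aestronglyMeasurable
    · filter_upwards [ae_restrict_mem measurableSet_Ioc] with r hr
      have h2 : rightTranslation.op r.toNNReal φ = translation (-r) φ := by
        change translation (-((r.toNNReal : ℝ≥0) : ℝ)) φ = _
        rw [Real.coe_toNNReal _ hr.1.le]
      rw [h2]
      simpa only [sub_eq_add_neg] using translation_coeFn (-r) φ
  filter_upwards [h1] with s hs
  have h2 : primitive (translation (-(h : ℝ)) φ) s = primitive φ (s - h) := by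
    rw [primitive_congr (translation_coeFn (-(h : ℝ)) φ), primitive]
    have h3 := (measurePreserving_add_right volume (-(h : ℝ))).setIntegral_preimage_emb
      (measurableEmbedding_addRight (-(h : ℝ))) φ (Iic (s - h))
    rw [preimage_add_const_Iic, sub_neg_eq_add, sub_add_cancel] at h3
    exact h3
  have h4 : φ - translation (-(h : ℝ)) φ = φ + (-1 : ℂ) • translation (-(h : ℝ)) φ := by module
  rw [hs, h4, primitive_add, primitive_smul, h2, neg_one_mul, ← sub_eq_add_neg,
    primitive_sub_primitive, intervalIntegral.integral_comp_sub_left (fun x => φ x), sub_zero]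

/-- Primitives of integrable functions are dense in `L¹(L)`. -/
theorem denseRange_restrictFst (hL : MeasurableSet L) : DenseRange (restrictFst L) := by
  intro x
  set φ := extendByZero hL x with hφ
  have h1 : LpToLpRestrictCLM ℝ ℂ ℂ volume 1 L φ = x := by
    apply Lp.ext
    filter_upwards [LpToLpRestrictCLM_coeFn ℂ L φ, ae_restrict_of_ae (extendByZero_coeFn hL x),
      ae_restrict_mem hL] with s h2 h3 hs
    rw [h2, hφ, h3, indicator_of_mem hs]
  have h2 := ((LpToLpRestrictCLM ℝ ℂ ℂ volume 1 L).continuous.tendsto φ).comp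
    (tendsto_average_orbit hasContinuousOrbits_rightTranslation φ)
  rw [h1] at h2
  refine mem_closure_of_tendsto h2 (Eventually.of_forall fun h => ?_)
  have h3 : (orbitIntegral rightTranslation h φ, φ - translation (-(h : ℝ)) φ) ∈
      primitiveGraph L := ae_restrict_of_ae (orbitIntegral_rightTranslation_coeFn h φ)
  exact ⟨⟨_, Submodule.smul_mem _ (((h : ℝ) : ℂ)⁻¹) h3⟩, rfl⟩

/-- The bounded extension `L¹(L) → L¹(K)` of `ψ ↦ (r ↦ C (ψ(· + r)))`. -/
def observationOperator (hK : MeasurableSet K) (hL : MeasurableSet L)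
    (hlow : IsLowerSet L) (hKL : K ⊆ L) :
    Lp ℂ 1 (volume.restrict L) →L[ℂ] Lp ℂ 1 (volume.restrict K) :=
  (observationLinear C hK hL hlow hKL).extendOfNorm (restrictFst L)

theorem norm_observationOperator_le (hK : MeasurableSet K) (hL : MeasurableSet L)
    (hlow : IsLowerSet L) (hKL : K ⊆ L) : ‖observationOperator C hK hL hlow hKL‖ ≤ ‖C‖ :=
  LinearMap.opNorm_extendOfNorm_le (denseRange_restrictFst hL) C.opNorm_nonneg
    (norm_observationLinear_le C hK hL hlow hKL)

/-- The bounded extension `L¹(J) → L¹(K)` of `φ ↦ (r ↦ C (φ(· + r)))`, where `φ` is extended by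
zero; on the lower set `L` only the values of `φ` on `L` matter. -/
def outputMap {J : Set ℝ} (hJ : MeasurableSet J) (hK : MeasurableSet K) (hL : MeasurableSet L)
    (hlow : IsLowerSet L) (hKL : K ⊆ L) :
    Lp ℂ 1 (volume.restrict J) →L[ℂ] Lp ℂ 1 (volume.restrict K) :=
  (observationOperator C hK hL hlow hKL).comp
    ((LpToLpRestrictCLM ℝ ℂ ℂ volume 1 L).comp (extendByZero hJ))

theorem norm_outputMap_le {J : Set ℝ} (hJ : MeasurableSet J) (hK : MeasurableSet K)
    (hL : MeasurableSet L) (hlow : IsLowerSet L) (hKL : K ⊆ L) :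
    ‖outputMap C hJ hK hL hlow hKL‖ ≤ ‖C‖ := by
  refine (ContinuousLinearMap.opNorm_comp_le _ _).trans
    ((mul_le_of_le_one_right (norm_nonneg _) ?_).trans
      (norm_observationOperator_le C hK hL hlow hKL))
  exact (ContinuousLinearMap.opNorm_comp_le _ _).trans
    (mul_le_one₀ (norm_restrict_le _) (norm_nonneg _) (norm_extendByZero_le _))

theorem outputMap_coeFn {J : Set ℝ} (hJ : MeasurableSet J) (hK : MeasurableSet K)
    (hL : MeasurableSet L) (hlow : IsLowerSet L) (hKL : K ⊆ L) {φ : Lp ℂ 1 (volume.restrict J)}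
    {G : Lp ℂ 1 (volume : Measure ℝ)}
    (h : J.indicator φ =ᵐ[volume.restrict L] primitive G) :
    outputMap C hJ hK hL hlow hKL φ =ᵐ[volume.restrict K] fun r => C (shiftedPrimitive G r) := by
  let q : primitiveGraph L := ⟨(extendByZero hJ φ, G),
    EventuallyEq.trans (ae_restrict_of_ae (extendByZero_coeFn hJ φ)) h⟩
  have h1 : outputMap C hJ hK hL hlow hKL φ = observationLinear C hK hL hlow hKL q :=
    LinearMap.extendOfNorm_eq (denseRange_restrictFst hL)
      ⟨_, norm_observationLinear_le C hK hL hlow hKL⟩ q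
  rw [h1]
  exact MemLp.coeFn_toLp (memLp_functional_shiftedPrimitive C hK hL hlow hKL q)

end ObservationOperator

/-! ### The observation maps -/

section Observation

/-- A function `f ∈ W^{1,1}(ℝ₋)` with `f(0) = 0` is the primitive of `f'` based at `-∞`: the
constant by which the two differ vanishes because `f` is integrable. -/
theorem IsW11.indicator_ae_eq_primitive {f g : L1Neg} (h : IsW11 f g 0) :
    (Iic (0 : ℝ)).indicator f =ᵐ[volume] primitive (zeroExtension g) := by
  set W := primitive (zeroExtension g) with hW
  have h1 : (Iic (0 : ℝ)).indicator f =ᵐ[volume] fun x => W x - W 0 := by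
    filter_upwards [h.indicator_ae_eq] with x hx
    rw [hx, hW, primitive_sub_primitive, intervalIntegral.integral_symm, neg_neg]
    exact intervalIntegral.integral_congr_ae
      ((zeroExtension_coeFn g).symm.mono fun y hy _ => hy)
  have h2 : IntegrableAtFilter (fun x => W x - W 0) atBot volume :=
    ((integrable_indicator_coe f).congr h1).integrableAtFilter atBot
  have h3 : 0 - W 0 = 0 := by
    refine h2.eq_zero_of_tendsto ?_ ((tendsto_primitive_atBot _).sub_const _)
    intro s hs
    obtain ⟨b, hb⟩ := mem_atBot_sets.1 hs
    refine top_le_iff.1 ?_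
    rw [← Real.volume_Iic (a := b)]
    exact measure_mono hb
  filter_upwards [h1] with x hx
  rw [hx, sub_eq_add_neg, ← zero_sub, h3, add_zero]

theorem leftTranslation_coeFn_eq_primitive {f g : L1Neg}
    (h : (f, g) ∈ (generator leftTranslation.op).graph) (r : ℝ≥0) :
    leftTranslation.op r f =ᵐ[volume.restrict (Iic (0 : ℝ))]
      fun s => primitive (zeroExtension g) (s + r) := by
  have h1 := (measurePreserving_add_right volume (r : ℝ)).quasiMeasurePreserving.ae_eq_comp
    ((mem_generator_leftTranslation_iff f g).1 h).indicator_ae_eq_primitive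
  filter_upwards [leftTranslationOp_coeFn r f, ae_restrict_of_ae h1] with s h2 h3
  exact h2.trans h3

theorem norm_zeroExtension_apply_le (g : L1Neg) : ‖zeroExtension g‖ ≤ ‖g‖ := by
  simpa using zeroExtension.le_of_opNorm_le norm_zeroExtension_le g

/-- The value `T(r)f` of an orbit starting in the domain of the generator, as an element of
`L¹(ℝ₋) ∩ C₀(ℝ₋)`. -/
def orbitL1CapC0 {f g : L1Neg} (h : (f, g) ∈ (generator leftTranslation.op).graph) (r : ℝ≥0) :
    l1CapC0 :=
  ⟨(leftTranslation.op r f, shiftedPrimitive (zeroExtension g) r), by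
    filter_upwards [leftTranslation_coeFn_eq_primitive h r] with s hs _
    exact hs⟩

theorem isIntermediateSpace_l1CapC0 :
    IsIntermediateSpace (Z := l1CapC0) leftTranslation l1CapC0ToL1 where
  complete := isClosed_l1CapC0.completeSpace_coe
  injective := injective_l1CapC0ToL1
  domain_embeds := by
    refine ⟨1, ?_⟩
    rintro ⟨f, g⟩ h
    refine ⟨orbitL1CapC0 h 0, ?_, ?_⟩
    · change leftTranslation.op 0 f = f
      rw [leftTranslation.op_zero, ContinuousLinearMap.id_apply]
    · change max ‖leftTranslation.op 0 f‖ ‖shiftedPrimitive (zeroExtension g) 0‖ ≤ _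
      rw [leftTranslation.op_zero, ContinuousLinearMap.id_apply, one_mul]
      have h1 := (norm_shiftedPrimitive_le (zeroExtension g) 0).trans
        (norm_zeroExtension_apply_le g)
      exact max_le (le_add_of_nonneg_right (norm_nonneg _))
        (h1.trans (le_add_of_nonneg_left (norm_nonneg _)))

variable (C : C₀(Iic (0 : ℝ), ℂ) →L[ℂ] ℂ)

/-- The observation map `L¹(ℝ₋) → L¹(0,t)`. -/
def observationMap (t : ℝ) : L1Neg →L[ℂ] Lp ℂ 1 (volume.restrict (Ioc 0 t)) :=
  outputMap C (J := Iic 0) (K := Ioc 0 t) (L := Iic t) measurableSet_Iic measurableSet_Ioc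
    measurableSet_Iic (isLowerSet_Iic t) Ioc_subset_Iic_self

theorem norm_observationMap_le (t : ℝ) : ‖observationMap C t‖ ≤ ‖C‖ :=
  norm_outputMap_le C _ _ _ _ _

theorem isObservationMap_observationMap (t : ℝ) :
    IsObservationMap (Z := l1CapC0) leftTranslation l1CapC0ToL1 (restrictFunctional C) 1 t
      (observationMap C t) := by
  intro f hf
  obtain ⟨g, h⟩ := LinearPMap.mem_domain_iff.1 hf
  refine ⟨fun s => orbitL1CapC0 h s.toNNReal, fun _ _ => rfl, ?_⟩
  have h1 := ((mem_generator_leftTranslation_iff f g).1 h).indicator_ae_eq_primitive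
  have h2 : observationMap C t f =ᵐ[volume.restrict (Ioc 0 t)]
      fun r => C (shiftedPrimitive (zeroExtension g) r) :=
    outputMap_coeFn C measurableSet_Iic measurableSet_Ioc measurableSet_Iic (isLowerSet_Iic t)
      Ioc_subset_Iic_self (ae_restrict_of_ae h1)
  filter_upwards [h2, ae_restrict_mem measurableSet_Ioc] with s hs hs0
  rw [hs]
  change _ = C (shiftedPrimitive (zeroExtension g) ((s.toNNReal : ℝ≥0) : ℝ))
  rw [Real.coe_toNNReal _ hs0.1.le]

end Observation

/-! ### Admissibility and invertibility from bounds on the maps -/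

section Admissibility

variable {X Z U : Type*} [NormedAddCommGroup X] [NormedSpace ℂ X]
  [NormedAddCommGroup Z] [NormedSpace ℂ Z] [NormedAddCommGroup U] [NormedSpace ℂ U]

theorem IsObservationMap.isAdmissibleObservation {T : C0Semigroup X} {j : Z →L[ℂ] X}
    {C : Z →L[ℂ] U} {t : ℝ} (ht : 0 < t) {Ψ : X →L[ℂ] Lp U 1 (volume.restrict (Ioc 0 t))}
    (h : IsObservationMap T j C 1 t Ψ) : IsAdmissibleObservation T j C 1 := by
  refine ⟨‖Ψ‖, norm_nonneg _, t, ht, fun x hx => ?_⟩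
  obtain ⟨z, hz, hΨ⟩ := h x hx
  refine ⟨z, hz, (memLp_congr_ae hΨ).1 (Lp.memLp _), ?_⟩
  simp only [ENNReal.toReal_one, Real.rpow_one]
  calc ∫ s in Ioc 0 t, ‖C (z s)‖ = ‖Ψ x‖ := by
        rw [L1.norm_eq_integral_norm]
        exact integral_congr_ae (hΨ.symm.mono fun s hs => congrArg norm hs)
    _ ≤ ‖Ψ‖ * ‖x‖ := Ψ.le_opNorm x

theorem IsInputOutputMap.isAdmissiblePair {T : C0Semigroup X} {μ : ℂ} {j : Z →L[ℂ] X}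
    {B : U →L[ℂ] Extrapolation T μ} {C : Z →L[ℂ] U} {t : ℝ} (ht : 0 < t)
    {F : Lp U 1 (volume.restrict (Ioc 0 t)) →L[ℂ] Lp U 1 (volume.restrict (Ioc 0 t))}
    (h : IsInputOutputMap T μ j B C 1 (Ioc 0 t) F) : IsAdmissiblePair T μ j B C 1 := by
  refine ⟨‖F‖, norm_nonneg _, t, ht, fun u hu => ?_⟩
  obtain ⟨z, hz, hF⟩ := h u (hu.1.toLp u) hu hu.1.coeFn_toLp
  refine ⟨z, hz, (memLp_congr_ae hF).1 (Lp.memLp _), ?_⟩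
  simp only [ENNReal.toReal_one, Real.rpow_one]
  calc ∫ r in Ioc 0 t, ‖C (z r)‖ = ‖F (hu.1.toLp u)‖ := by
        rw [L1.norm_eq_integral_norm]
        exact integral_congr_ae (hF.symm.mono fun s hs => congrArg norm hs)
    _ ≤ ‖F‖ * ‖hu.1.toLp u‖ := F.le_opNorm _
    _ = ‖F‖ * ∫ r in Ioc 0 t, ‖u r‖ := by
        rw [L1.norm_eq_integral_norm]
        congr 1
        exact integral_congr_ae (hu.1.coeFn_toLp.mono fun s hs => congrArg norm hs)

theorem norm_inverse_one_sub_le {E : Type*} [NormedAddCommGroup E] [NormedSpace ℂ E]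
    [CompleteSpace E] {F : E →L[ℂ] E} {c : ℝ} (hF : ‖F‖ ≤ c) (hc : c < 1) :
    IsUnit (1 - F) ∧ ‖Ring.inverse (1 - F)‖ ≤ (1 - c)⁻¹ := by
  have h1 : ‖F‖ < 1 := hF.trans_lt hc
  refine ⟨isUnit_one_sub_of_norm_lt_one h1, ?_⟩
  rw [NormedRing.inverse_one_sub F h1]
  refine (tsum_geometric_le_of_norm_lt_one F h1).trans ?_
  have h2 : ‖(1 : E →L[ℂ] E)‖ ≤ 1 := ContinuousLinearMap.norm_id_le
  have h3 : (1 - ‖F‖)⁻¹ ≤ (1 - c)⁻¹ := inv_anti₀ (by linarith) (by linarith)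
  linarith

end Admissibility

/-! ### The input-output maps -/

section InputOutput

variable (C : C₀(Iic (0 : ℝ), ℂ) →L[ℂ] ℂ) {I L : Set ℝ}

/-- Extended by zero to the left, a function in `W^{2,1}(I)` which vanishes at `0` coincides on `L`
with the primitive of `u'`. -/
theorem MemW2pZero.exists_primitive {u : ℝ → ℂ} (hu : MemW2pZero 1 I u) (hL : MeasurableSet L)
    (hlow : IsLowerSet L) (hI : I = L ∩ Ioi 0) :
    ∃ G : Lp ℂ 1 (volume : Measure ℝ), ∀ x ∈ L, I.indicator u x = primitive G x := by
  obtain ⟨-, v, w, hv, -, huv, -⟩ := hu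
  have hIm : MeasurableSet I := hI ▸ hL.inter measurableSet_Ioi
  refine ⟨extendByZero hIm (hv.toLp v), fun x hx => ?_⟩
  have h1 : extendByZero hIm (hv.toLp v) =ᵐ[volume] I.indicator v :=
    (extendByZero_coeFn hIm _).trans
      ((ae_eq_restrict_iff_indicator_ae_eq hIm).1 hv.coeFn_toLp)
  rw [primitive_congr h1, setIntegral_indicator hIm]
  have h2 : Iic x ∩ I = Ioc 0 x := by
    ext y
    rw [hI]
    constructor
    · rintro ⟨hy, -, hy0⟩
      exact ⟨hy0, hy⟩
    · rintro ⟨hy0, hy⟩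
      exact ⟨hy, hlow hy hx, hy0⟩
  rw [h2]
  by_cases hx0 : 0 < x
  · have hxI : x ∈ I := hI ▸ ⟨hx, hx0⟩
    rw [indicator_of_mem hxI, huv x hxI, intervalIntegral.integral_of_le hx0.le]
  · have hxI : x ∉ I := fun h => hx0 (hI ▸ h : x ∈ L ∩ Ioi 0).2
    rw [indicator_of_notMem hxI, Ioc_eq_empty (fun h => hx0 h), setIntegral_empty]

/-- The input-output map on `L¹(I)`, where `I` is the positive part of the lower set `L`. -/
def inputOutputMap (hL : MeasurableSet L) (hlow : IsLowerSet L) (hI : I = L ∩ Ioi 0) :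
    Lp ℂ 1 (volume.restrict I) →L[ℂ] Lp ℂ 1 (volume.restrict I) :=
  outputMap C (hI ▸ hL.inter measurableSet_Ioi) (hI ▸ hL.inter measurableSet_Ioi) hL hlow
    (hI ▸ inter_subset_left)

theorem norm_inputOutputMap_le (hL : MeasurableSet L) (hlow : IsLowerSet L)
    (hI : I = L ∩ Ioi 0) : ‖inputOutputMap C hL hlow hI‖ ≤ ‖C‖ :=
  norm_outputMap_le C _ _ _ _ _

/-- On `I`, the convolution integral at time `r` is represented by the translate by `r` of the
extension of `u` by zero. This is a continuous function, since `u` vanishes at `0`. -/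
theorem isInputOutputMap_inputOutputMap {μ : ℂ}
    (hμ : μ ∈ resolventSet (generator leftTranslation.op)) (h0 : 0 < μ.re)
    (hL : MeasurableSet L) (hlow : IsLowerSet L) (hI : I = L ∩ Ioi 0) :
    IsInputOutputMap (Z := l1CapC0) leftTranslation μ l1CapC0ToL1 (controlOperator hμ h0)
      (restrictFunctional C) 1 I (inputOutputMap C hL hlow hI) := by
  intro u φ hu hφ
  have hIm : MeasurableSet I := hI ▸ hL.inter measurableSet_Ioi
  obtain ⟨G, hG⟩ := hu.exists_primitive hL hlow hI
  have key : ∀ r, ∃ z : l1CapC0, r ∈ I →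
      toExtrapolation leftTranslation μ (l1CapC0ToL1 z) =
        convolution leftTranslation μ (controlOperator hμ h0) u r ∧
      restrictFunctional C z = C (shiftedPrimitive G r) := by
    intro r
    by_cases hr : r ∈ I
    swap
    · exact ⟨0, fun h => absurd h hr⟩
    have hr' : r ∈ L ∧ 0 < r := by
      rw [hI] at hr
      exact hr
    have hsub : Ioc 0 r ⊆ I := by
      intro x hx
      rw [hI]
      exact ⟨hlow hx.2 hr'.1, hx.1⟩
    have hur : MemLp u 1 (volume.restrict (Ioc 0 r)) :=
      hu.1.mono_measure (Measure.restrict_mono hsub le_rfl)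
    refine ⟨⟨(controlMap r (hur.toLp u), shiftedPrimitive G r), ?_⟩, fun _ => ⟨?_, rfl⟩⟩
    · have h1 := (measurePreserving_add_right volume r).quasiMeasurePreserving.ae_eq_comp
        ((ae_eq_restrict_iff_indicator_ae_eq measurableSet_Ioc).1 hur.coeFn_toLp)
      filter_upwards [controlMap_coeFn r (hur.toLp u), ae_restrict_of_ae h1] with s h2 h3 hs
      have hs0 : s ≤ 0 := hs
      have hsr : s + r ≤ r := by linarith
      rw [h2]
      refine Eq.trans h3 ?_
      rw [shiftedPrimitive_apply, ← hG _ (hlow hsr hr'.1), Function.comp_apply]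
      by_cases hm : s + r ∈ I
      · have hm' : 0 < s + r := by
          rw [hI] at hm
          exact hm.2
        rw [indicator_of_mem hm, indicator_of_mem (show s + r ∈ Ioc 0 r from ⟨hm', hsr⟩)]
      · rw [indicator_of_notMem hm, indicator_of_notMem (fun h => hm (hsub h))]
    · exact toExtrapolation_controlMap_toLp hμ h0 hr'.2 hur
  choose z hz using key
  refine ⟨z, fun r hr => (hz r hr).1, ?_⟩
  have h1 : I.indicator φ =ᵐ[volume.restrict L] primitive G := by
    filter_upwards [ae_restrict_of_ae ((ae_eq_restrict_iff_indicator_ae_eq hIm).1 hφ),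
      ae_restrict_mem hL] with x hx hxL
    rw [hx, hG x hxL]
  filter_upwards [outputMap_coeFn C hIm hIm hL hlow (hI ▸ inter_subset_left) h1,
    ae_restrict_mem hIm] with r hr hrI
  rw [(hz r hrI).2, ← hr]
  rfl

/-- `(B, C)` is an infinite-time Staffans–Weiss perturbation: since `‖F_t‖ ≤ ‖C‖ < 1` the Neumann
series inverts `1 - F_t` uniformly in `t`. -/
theorem isInfiniteTimeStaffansWeiss {C : C₀(Iic (0 : ℝ), ℂ) →L[ℂ] ℂ} (hC : ‖C‖ < 1) {μ : ℂ}
    (hμ : μ ∈ resolventSet (generator leftTranslation.op)) (h0 : 0 < μ.re) :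
    IsInfiniteTimeStaffansWeiss (Z := l1CapC0) (U := ℂ) leftTranslation μ l1CapC0ToL1
      (controlOperator hμ h0) (restrictFunctional C) 1 := by
  let F (t : ℝ) := inputOutputMap C measurableSet_Iic (isLowerSet_Iic t)
    (inter_comm (Iic t) (Ioi 0)).symm
  have hF : ∀ t, IsInputOutputMap (Z := l1CapC0) leftTranslation μ l1CapC0ToL1
      (controlOperator hμ h0) (restrictFunctional C) 1 (Ioc 0 t) (F t) := fun t =>
    isInputOutputMap_inputOutputMap C hμ h0 measurableSet_Iic (isLowerSet_Iic t) _
  have hinv : ∀ t, IsUnit (1 - F t) ∧ ‖Ring.inverse (1 - F t)‖ ≤ (1 - ‖C‖)⁻¹ := fun t =>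
    norm_inverse_one_sub_le (norm_inputOutputMap_le C _ _ _) hC
  exact
    { ne_top := ENNReal.one_ne_top
      base_point := hμ
      intermediate := isIntermediateSpace_l1CapC0
      compatible := isCompatible_controlOperator hμ h0
      control := isAdmissibleControl_controlOperator hμ h0
      observation := (isObservationMap_observationMap C 1).isAdmissibleObservation one_pos
      pair := (hF 1).isAdmissiblePair one_pos
      invertible := ⟨1, one_pos, F 1, hF 1, (hinv 1).1⟩
      infinite_control := isInfiniteTimeAdmissibleControl_controlOperator hμ h0
      uniform_inverse := by
        refine ⟨(1 - ‖C‖)⁻¹ * ‖C‖, fun t _ => ⟨F t, observationMap C t, hF t,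
          isObservationMap_observationMap C t, (hinv t).1, ?_⟩⟩
        refine (ContinuousLinearMap.opNorm_comp_le _ _).trans ?_
        exact mul_le_mul (hinv t).2 (norm_observationMap_le C t) (norm_nonneg _)
          (inv_nonneg.2 (by linarith)) }

end InputOutput

end SW

end

theorem mainTheorem8 (C : C₀(Iic (0 : ℝ), ℂ) →L[ℂ] ℂ) (hC : ‖C‖ < 1) :
    -- the generator of the left translation semigroup
    (∀ f g : SW.L1Neg,
      (f, g) ∈ (SW.generator SW.leftTranslation.op).graph ↔ SW.IsW11 f g 0) ∧
    SW.resolventSet (SW.generator SW.leftTranslation.op) = {ν : ℂ | 0 < ν.re} ∧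
    ∀ ν ∈ SW.resolventSet (SW.generator SW.leftTranslation.op),
      ∃ D : ℂ →L[ℂ] SW.L1Neg, SW.IsDirichletOperator ν D ∧
        (∀ c : ℂ, D c =ᵐ[volume.restrict (Iic (0 : ℝ))] fun s => c * Complex.exp (ν * s)) ∧
        -- `μ` is the base point used to define the norm of the extrapolation space
        ∀ μ ∈ SW.resolventSet (SW.generator SW.leftTranslation.op),
          ∃ B : ℂ →L[ℂ] SW.Extrapolation SW.leftTranslation μ,
            SW.IsBoundaryControl SW.leftTranslation μ ν D B ∧
            SW.IsInfiniteTimeStaffansWeiss (Z := SW.l1CapC0) (U := ℂ) SW.leftTranslation μ SW.l1CapC0ToL1 B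
              (SW.restrictFunctional C) 1 ∧
            -- the control maps
            (∀ t : ℝ, 0 < t → ∃ Φ : Lp ℂ 1 (volume.restrict (Ioc 0 t)) →L[ℂ] SW.L1Neg,
              SW.IsControlMap SW.leftTranslation μ B 1 t Φ ∧ ‖Φ‖ ≤ 1 ∧
              ∀ u, Φ u =ᵐ[volume.restrict (Iic (0 : ℝ))]
                fun s => if -t < s then u (s + t) else 0) ∧
            -- the input-output map on the half-line
            (∃ F : Lp ℂ 1 (volume.restrict (Ioi (0 : ℝ))) →L[ℂ]
                Lp ℂ 1 (volume.restrict (Ioi (0 : ℝ))),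
              SW.IsInputOutputMap (Z := SW.l1CapC0) (U := ℂ) SW.leftTranslation μ SW.l1CapC0ToL1 B
                (SW.restrictFunctional C) 1 (Ioi 0) F ∧ ‖F‖ ≤ ‖C‖) := by
  refine ⟨SW.mem_generator_leftTranslation_iff, SW.resolventSet_leftTranslation, fun ν hν => ?_⟩
  rw [SW.resolventSet_leftTranslation] at hν
  refine ⟨SW.dirichlet hν, SW.isDirichletOperator_dirichlet hν, SW.dirichlet_coeFn hν,
    fun μ hμ => ?_⟩
  have h0 : 0 < μ.re := by
    rw [SW.resolventSet_leftTranslation] at hμ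
    exact hμ
  refine ⟨SW.controlOperator hμ h0, SW.isBoundaryControl_controlOperator hμ h0 hν,
    SW.isInfiniteTimeStaffansWeiss hC hμ h0, fun t ht => ?_, ?_⟩
  · exact ⟨SW.controlMap t, fun u => SW.toExtrapolation_controlMap hμ h0 ht u,
      SW.norm_controlMap_le t, SW.controlMap_coeFn_ite t⟩
  · exact ⟨SW.inputOutputMap C MeasurableSet.univ isLowerSet_univ (univ_inter _).symm,
      SW.isInputOutputMap_inputOutputMap C hμ h0 _ _ _, SW.norm_inputOutputMap_le C _ _ _⟩
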